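/- Let $n\ge 1$, let $\mathbb{B}^n=\{z\in\mathbb{C}^n : |z|^2=|z_1|^2+\cdots+|z_n|^2<1\}$ and let $\mu(z)=\exp\left(\frac{1}{|z|^2-1}\right)$ for $z\in\mathbb{B}^n$. Let $L^2(\mathbb{B}^n,\mu)$ be the space of complex functions on $\mathbb{B}^n$ that are square integrable with respect to $\mu\,dV$, where $dV$ is Lebesgue measure, let $L^2_a(\mathbb{B}^n,\mu)$ be its closed subspace of holomorphic functions, and let the weighted Bergman projection $\mathbf{B}^{\mu}$ be the orthogonal projection of $L^2(\mathbb{B}^n,\mu)$ onto $L^2_a(\mathbb{B}^n,\mu)$. For an integer $k\ge 0$ let $W^k(\mathbb{B}^n,\mu)$ be the space of all $f\in L^2(\mathbb{B}^n,\mu)$ whose distributional derivatives $\frac{\partial^{\beta+\gamma}f}{\partial\bar z^{\beta}\partial z^{\gamma}}$ with $|\beta+\gamma|\le k$ all lie in $L^2(\mathbb{B}^n,\mu)$, with the norm $$\|f\|_{k,\mu}^2=\sum_{|\beta+\gamma|\le k}\int_{\mathbb{B}^n}\left|\frac{\partial^{\beta+\gamma}f}{\partial\bar z^{\beta}\partial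 z^{\gamma}}(z)\right|^2\mu(z)\,dV(z),$$ where $\beta,\gamma$ run over multi-indices in $\mathbb{N}_0^n$. Then for every integer $k\ge 0$ the operator $\mathbf{B}^{\mu}$ is bounded on $W^k(\mathbb{B}^n,\mu)$: there is a constant $C$, depending only on $n$ and $k$, such that for every $f\in W^k(\mathbb{B}^n,\mu)$ one has $\mathbf{B}^{\mu}f\in W^k(\mathbb{B}^n,\mu)$ and $\|\mathbf{B}^{\mu}f\|_{k,\mu}\le C\,\|f\|_{k,\mu}$. -/

import Mathlib

noncomputable section

namespace WeightedBergman

open MeasureTheory Filter Topology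
open scoped ContDiff

/-- The open Euclidean unit ball of `ℂⁿ`. The space `Fin n → ℂ` carries the product topology and
the product Lebesgue measure; the Euclidean norm is written out. -/
def unitBall (n : ℕ) : Set (Fin n → ℂ) :=
  {z | ∑ i, ‖z i‖ ^ 2 < 1}

/-- The weight `μ(z) = exp (1 / (|z|² - 1))`. -/
def weight {n : ℕ} (z : Fin n → ℂ) : ℝ :=
  Real.exp (1 / (∑ i, ‖z i‖ ^ 2 - 1))

/-- The measure `μ(z) dV(z)` on the unit ball. -/
def weightedVolume (n : ℕ) : Measure (Fin n → ℂ) :=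
  (volume.restrict (unitBall n)).withDensity fun z => ENNReal.ofReal (weight z)

/-- The weighted Hilbert space `L²(𝔹ⁿ, μ)`. -/
abbrev WeightedL2 (n : ℕ) : Type :=
  Lp ℂ 2 (weightedVolume n)

/-- The weighted Bergman space `L²ₐ(𝔹ⁿ, μ)`: the classes in `L²(𝔹ⁿ, μ)` with a holomorphic
representative. -/
def bergmanSpace (n : ℕ) : Submodule ℂ (WeightedL2 n) where
  carrier := {f | ∃ F : (Fin n → ℂ) → ℂ, DifferentiableOn ℂ F (unitBall n) ∧
    f =ᵐ[weightedVolume n] F}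
  zero_mem' := ⟨0, differentiableOn_const 0, Lp.coeFn_zero _ _ _⟩
  add_mem' := by
    rintro f g ⟨F, hF, hfF⟩ ⟨G, hG, hgG⟩
    exact ⟨F + G, hF.add hG, (Lp.coeFn_add f g).trans (hfF.add hgG)⟩
  smul_mem' := by
    rintro c f ⟨F, hF, hfF⟩
    exact ⟨c • F, hF.const_smul c, (Lp.coeFn_smul c f).trans (hfF.const_smul c)⟩

/-! The weighted Bergman space is closed, so that the orthogonal projection onto it exists. -/

theorem isOpen_unitBall (n : ℕ) : IsOpen (unitBall n) :=
  isOpen_lt (by fun_prop) continuous_const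

theorem weight_pos {n : ℕ} (z : Fin n → ℂ) : 0 < weight z := Real.exp_pos _

theorem continuousOn_weight (n : ℕ) : ContinuousOn (weight (n := n)) (unitBall n) := by
  unfold weight
  refine Real.continuous_exp.comp_continuousOn (ContinuousOn.div continuousOn_const
    (by fun_prop) fun z hz => ?_)
  have : ∑ i, ‖z i‖ ^ 2 < 1 := hz
  linarith

theorem measurable_weight (n : ℕ) : Measurable (weight (n := n)) := by
  unfold weight
  fun_prop

theorem volume_restrict_absolutelyContinuous (n : ℕ) :
    volume.restrict (unitBall n) ≪ weightedVolume n :=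
  withDensity_absolutelyContinuous' (measurable_weight n).ennreal_ofReal.aemeasurable
    (Eventually.of_forall fun z => by simpa using weight_pos z)

theorem weightedVolume_absolutelyContinuous (n : ℕ) :
    weightedVolume n ≪ volume.restrict (unitBall n) :=
  withDensity_absolutelyContinuous _ _

/-- On a compact subset of the ball Lebesgue measure is bounded by a multiple of `μ dV`. -/
theorem exists_restrict_le {n : ℕ} {K : Set (Fin n → ℂ)} (hK : IsCompact K)
    (hKs : K ⊆ unitBall n) :
    ∃ c : NNReal, volume.restrict K ≤ (c : ENNReal) • weightedVolume n := by
  obtain ⟨c, hc, hcK⟩ : ∃ c : ℝ, 0 < c ∧ ∀ z ∈ K, c ≤ weight z := by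
    rcases K.eq_empty_or_nonempty with rfl | hne
    · exact ⟨1, one_pos, by simp⟩
    · obtain ⟨z, hz, hmin⟩ := hK.exists_isMinOn hne ((continuousOn_weight n).mono hKs)
      exact ⟨weight z, weight_pos z, fun w hw => hmin hw⟩
  refine ⟨(c⁻¹).toNNReal, Measure.le_iff.2 fun s hs => ?_⟩
  have h1 : ENNReal.ofReal c * volume (s ∩ K) ≤ weightedVolume n s := by
    rw [weightedVolume, withDensity_apply _ hs, Measure.restrict_restrict hs]
    calc ENNReal.ofReal c * volume (s ∩ K)
        = ∫⁻ _ in s ∩ K, ENNReal.ofReal c := by simp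
      _ ≤ ∫⁻ z in s ∩ K, ENNReal.ofReal (weight z) :=
          setLIntegral_mono' (hs.inter hK.measurableSet) fun z hz =>
            ENNReal.ofReal_le_ofReal (hcK z hz.2)
      _ ≤ _ := lintegral_mono_set (Set.inter_subset_inter_right _ hKs)
  rw [Measure.restrict_apply hs, Measure.smul_apply, smul_eq_mul]
  have h2 : ((c⁻¹).toNNReal : ENNReal) * ENNReal.ofReal c = 1 := by
    change ENNReal.ofReal c⁻¹ * ENNReal.ofReal c = 1
    rw [← ENNReal.ofReal_mul (inv_pos.2 hc).le, inv_mul_cancel₀ hc.ne', ENNReal.ofReal_one]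
  calc volume (s ∩ K) = ((c⁻¹).toNNReal : ENNReal) * (ENNReal.ofReal c * volume (s ∩ K)) := by
        rw [← mul_assoc, h2, one_mul]
    _ ≤ _ := by gcongr

/-- Mean value property over polydiscs. -/
theorem integral_polydisc {n : ℕ} {F : (Fin n → ℂ) → ℂ} {z : Fin n → ℂ} {ρ : ℝ}
    (hF : ∀ w ∈ Metric.closedBall z ρ, DifferentiableAt ℂ F w) :
    ∫ w in Metric.closedBall (0 : Fin n → ℂ) ρ, F (z + w) =
      (volume (Metric.closedBall (0 : Fin n → ℂ) ρ)).toReal • F z := by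
  set P := Metric.closedBall (0 : Fin n → ℂ) ρ with hP
  have hPc : IsCompact P := isCompact_closedBall _ _
  have hrot : ∀ θ : ℝ, ∫ w in P, F (z + circleMap 0 1 θ • w) = ∫ w in P, F (z + w) := by
    intro θ
    have hn : ‖circleMap 0 1 θ‖ = 1 := by simp
    have hne : circleMap 0 1 θ ≠ 0 := fun h => by simp [h] at hn
    let u : Circle := ⟨circleMap 0 1 θ, by simp [Submonoid.unitSphere]⟩
    have hmp : MeasurePreserving (fun w : Fin n → ℂ => circleMap 0 1 θ • w) := by
      refine volume_preserving_pi (f := fun _ : Fin n => fun x : ℂ => circleMap 0 1 θ * x)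
        fun _ => ?_
      exact (rotation u).measurePreserving
    have hemb : MeasurableEmbedding (fun w : Fin n → ℂ => circleMap 0 1 θ • w) :=
      (Homeomorph.smulOfNeZero (α := Fin n → ℂ) _ hne).measurableEmbedding
    have hpre : (fun w : Fin n → ℂ => circleMap 0 1 θ • w) ⁻¹' P = P := by
      ext w
      simp [hP, norm_smul]
    have := hmp.setIntegral_preimage_emb hemb (fun w => F (z + w)) P
    rwa [hpre] at this
  have hmem : ∀ w ∈ P, ∀ t : ℂ, ‖t‖ ≤ 1 → z + t • w ∈ Metric.closedBall z ρ := by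
    intro w hw t ht
    have hw' : ‖w‖ ≤ ρ := by simpa [hP] using hw
    simp only [Metric.mem_closedBall, dist_self_add_left, norm_smul]
    nlinarith [norm_nonneg w, norm_nonneg t]
  have hmean : ∀ w ∈ P, ∫ θ in (0 : ℝ)..2 * Real.pi, F (z + circleMap 0 1 θ • w)
      = (2 * Real.pi) • F z := by
    intro w hw
    have hd : DiffContOnCl ℂ (fun t : ℂ => F (z + t • w)) (Metric.ball 0 |1|) := by
      refine DifferentiableOn.diffContOnCl fun t ht => ?_
      have ht' : ‖t‖ ≤ 1 := by
        have := Metric.closure_ball_subset_closedBall ht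
        simpa using this
      exact ((hF _ (hmem w hw t ht')).comp t (by fun_prop)).differentiableWithinAt
    have h := hd.circleAverage
    rw [Real.circleAverage_def] at h
    simp only [zero_smul, add_zero] at h
    rw [← h, smul_smul, mul_inv_cancel₀ (by positivity), one_smul]
  have hint : Integrable (Function.uncurry fun (θ : ℝ) (w : Fin n → ℂ) =>
      F (z + circleMap 0 1 θ • w))
      ((volume.restrict (Set.uIoc 0 (2 * Real.pi))).prod (volume.restrict P)) := by
    rw [Measure.prod_restrict]
    have hc : ContinuousOn (Function.uncurry fun (θ : ℝ) (w : Fin n → ℂ) =>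
        F (z + circleMap 0 1 θ • w)) (Set.uIcc 0 (2 * Real.pi) ×ˢ P) := by
      rintro ⟨θ, w⟩ ⟨-, hw⟩
      refine ContinuousAt.continuousWithinAt ?_
      have hcF : ContinuousAt F (z + circleMap 0 1 θ • w) :=
        (hF _ (hmem w hw _ (by simp))).continuousAt
      have hcm : ContinuousAt (fun p : ℝ × (Fin n → ℂ) => z + circleMap 0 1 p.1 • p.2) (θ, w) := by
        have := continuous_circleMap 0 1
        fun_prop
      exact ContinuousAt.comp (f := fun p : ℝ × (Fin n → ℂ) => z + circleMap 0 1 p.1 • p.2)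
        (x := (θ, w)) hcF hcm
    have := hc.integrableOn_compact (μ := volume) (isCompact_uIcc.prod hPc)
    exact this.mono_set (Set.prod_mono Set.uIoc_subset_uIcc subset_rfl)
  have hswap := intervalIntegral_integral_swap hint
  simp only [hrot] at hswap
  rw [setIntegral_congr_fun hPc.measurableSet hmean] at hswap
  simp only [intervalIntegral.integral_const, sub_zero, integral_const, smul_smul] at hswap
  have hpi : (2 * Real.pi : ℝ) ≠ 0 := by positivity
  have := congrArg (fun x => (2 * Real.pi)⁻¹ • x) hswap
  simp only [smul_smul] at this
  rw [inv_mul_cancel₀ hpi, one_smul] at this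
  rw [this]
  congr 1
  simp only [Measure.real, Measure.restrict_apply MeasurableSet.univ, Set.univ_inter]
  field_simp

/-- Local uniform control of holomorphic functions by their weighted `L²` norm. -/
theorem exists_sup_bound {n : ℕ} {z₀ : Fin n → ℂ} (hz₀ : z₀ ∈ unitBall n) :
    ∃ ρ : ℝ, 0 < ρ ∧ Metric.closedBall z₀ ρ ⊆ unitBall n ∧ ∃ C : NNReal,
      ∀ F : (Fin n → ℂ) → ℂ, DifferentiableOn ℂ F (unitBall n) →
        ∀ z ∈ Metric.closedBall z₀ ρ, ‖F z‖ₑ ≤ C * eLpNorm F 2 (weightedVolume n) := by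
  obtain ⟨R, hR, hRs⟩ := Metric.nhds_basis_closedBall.mem_iff.1
    ((isOpen_unitBall n).mem_nhds hz₀)
  refine ⟨R / 2, by positivity, (Metric.closedBall_subset_closedBall (by linarith)).trans hRs, ?_⟩
  obtain ⟨c, hc⟩ := exists_restrict_le (isCompact_closedBall z₀ R) hRs
  set V := volume (Metric.closedBall (0 : Fin n → ℂ) (R / 2)) with hV
  have hV0 : V ≠ 0 := (Metric.measure_closedBall_pos _ _ (by positivity)).ne'
  have hVt : V ≠ ⊤ := (isCompact_closedBall _ _).measure_lt_top.ne
  have hCt : V⁻¹ * ((c : ENNReal) ^ (1 / (2 : ENNReal)).toReal * V ^ (1 / (1 : ENNReal).toReal -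
      1 / (2 : ENNReal).toReal)) ≠ ⊤ := by
    refine ENNReal.mul_ne_top (ENNReal.inv_ne_top.2 hV0) (ENNReal.mul_ne_top ?_ ?_)
    · exact ENNReal.rpow_ne_top_of_nonneg (by positivity) ENNReal.coe_ne_top
    · exact ENNReal.rpow_ne_top_of_nonneg (by norm_num) hVt
  refine ⟨(V⁻¹ * ((c : ENNReal) ^ (1 / (2 : ENNReal)).toReal * V ^ (1 / (1 : ENNReal).toReal -
      1 / (2 : ENNReal).toReal))).toNNReal, fun F hF z hz => ?_⟩
  rw [ENNReal.coe_toNNReal hCt]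
  have hsub : Metric.closedBall z (R / 2) ⊆ Metric.closedBall z₀ R := by
    refine Metric.closedBall_subset_closedBall' ?_
    have : dist z z₀ ≤ R / 2 := hz
    linarith
  have hsub' := hsub.trans hRs
  have hdiff : ∀ w ∈ Metric.closedBall z (R / 2), DifferentiableAt ℂ F w := fun w hw =>
    (hF w (hsub' hw)).differentiableAt ((isOpen_unitBall n).mem_nhds (hsub' hw))
  have hmean := integral_polydisc hdiff
  have htr : ∫ w in Metric.closedBall (0 : Fin n → ℂ) (R / 2), F (z + w) =
      ∫ w in Metric.closedBall z (R / 2), F w := by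
    have hpre : (fun w : Fin n → ℂ => z + w) ⁻¹' Metric.closedBall z (R / 2) =
        Metric.closedBall 0 (R / 2) := by
      ext w; simp
    have := (measurePreserving_add_left volume z).setIntegral_preimage_emb
      (measurableEmbedding_addLeft z) F (Metric.closedBall z (R / 2))
    rwa [hpre] at this
  have hVz : volume (Metric.closedBall z (R / 2)) = V := by
    rw [hV, Measure.addHaar_closedBall_center]
  rw [htr] at hmean
  have hcont : ContinuousOn F (Metric.closedBall z (R / 2)) := fun w hw =>
    (hdiff w hw).continuousAt.continuousWithinAt
  have hsm : AEStronglyMeasurable F (volume.restrict (Metric.closedBall z (R / 2))) :=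
    hcont.aestronglyMeasurable Metric.isClosed_closedBall.measurableSet
  have h1 : V * ‖F z‖ₑ ≤ eLpNorm F 1 (volume.restrict (Metric.closedBall z (R / 2))) := by
    rw [eLpNorm_one_eq_lintegral_enorm]
    refine le_trans (le_of_eq ?_) (enorm_integral_le_lintegral_enorm _)
    rw [hmean, enorm_smul, Real.enorm_of_nonneg ENNReal.toReal_nonneg, ENNReal.ofReal_toReal hVt]
  have h2 := eLpNorm_le_eLpNorm_mul_rpow_measure_univ (p := 1) (q := 2)
    (by norm_num) hsm
  rw [Measure.restrict_apply_univ, hVz] at h2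
  have h3 : eLpNorm F 2 (volume.restrict (Metric.closedBall z (R / 2))) ≤
      (c : ENNReal) ^ (1 / (2 : ENNReal)).toReal * eLpNorm F 2 (weightedVolume n) := by
    have := eLpNorm_mono_measure (p := 2) F ((Measure.restrict_mono_set volume hsub).trans hc)
    rwa [eLpNorm_smul_measure_of_ne_top (by norm_num), smul_eq_mul] at this
  calc ‖F z‖ₑ = V⁻¹ * (V * ‖F z‖ₑ) := by
        rw [← mul_assoc, ENNReal.inv_mul_cancel hV0 hVt, one_mul]
    _ ≤ V⁻¹ * (((c : ENNReal) ^ (1 / (2 : ENNReal)).toReal * eLpNorm F 2 (weightedVolume n)) *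
          V ^ (1 / (1 : ENNReal).toReal - 1 / (2 : ENNReal).toReal)) := by
        exact mul_le_mul_right ((h1.trans h2).trans (mul_le_mul_left h3 _)) _
    _ = _ := by ring

theorem isClosed_bergmanSpace (n : ℕ) : IsClosed (bergmanSpace n : Set (WeightedL2 n)) := by
  refine IsSeqClosed.isClosed fun f g hf hfg => ?_
  choose F hF hfF using hf
  have hsub : ∀ i j, eLpNorm (F i - F j) 2 (weightedVolume n) = edist (f i) (f j) := by
    intro i j
    rw [Lp.edist_def]
    exact eLpNorm_congr_ae ((hfF i).sub (hfF j)).symm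
  have hCau : CauchySeq f := hfg.cauchySeq
  -- local uniform Cauchy estimates
  have hloc : ∀ z₀ ∈ unitBall n, ∃ ρ : ℝ, 0 < ρ ∧ Metric.closedBall z₀ ρ ⊆ unitBall n ∧
      ∀ ε > 0, ∃ N, ∀ i ≥ N, ∀ j ≥ N, ∀ z ∈ Metric.closedBall z₀ ρ, ‖F i z - F j z‖ ≤ ε := by
    intro z₀ hz₀
    obtain ⟨ρ, hρ, hs, C, hC⟩ := exists_sup_bound hz₀
    refine ⟨ρ, hρ, hs, fun ε hε => ?_⟩
    obtain ⟨N, hN⟩ := Metric.cauchySeq_iff.1 hCau (ε / (C + 1)) (by positivity)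
    refine ⟨N, fun i hi j hj z hz => ?_⟩
    have h := hC (F i - F j) ((hF i).sub (hF j)) z hz
    rw [hsub i j, edist_dist, ← ofReal_norm, ← ENNReal.ofReal_coe_nnreal,
      ← ENNReal.ofReal_mul C.coe_nonneg,
      ENNReal.ofReal_le_ofReal_iff (by positivity)] at h
    have h' := (hN i hi j hj).le
    rw [le_div_iff₀ (by positivity)] at h'
    have : (0 : ℝ) ≤ dist (f i) (f j) := dist_nonneg
    simp only [Pi.sub_apply] at h
    linarith
  have hlim : ∀ z, ∃ y, z ∈ unitBall n → Tendsto (fun i => F i z) atTop (𝓝 y) := by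
    intro z
    by_cases hz : z ∈ unitBall n
    · obtain ⟨ρ, hρ, -, h⟩ := hloc z hz
      have : CauchySeq fun i => F i z := by
        refine Metric.cauchySeq_iff.2 fun ε hε => ?_
        obtain ⟨N, hN⟩ := h (ε / 2) (by positivity)
        refine ⟨N, fun i hi j hj => ?_⟩
        rw [dist_eq_norm]
        linarith [hN i hi j hj z (Metric.mem_closedBall_self hρ.le)]
      obtain ⟨y, hy⟩ := cauchySeq_tendsto_of_complete this
      exact ⟨y, fun _ => hy⟩
    · exact ⟨0, fun h => absurd h hz⟩
  choose G hG using hlim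
  refine ⟨G, fun z₀ hz₀ => ?_, ?_⟩
  · obtain ⟨ρ, hρ, hs, h⟩ := hloc z₀ hz₀
    have hbs : Metric.ball z₀ (ρ / 2) ⊆ unitBall n :=
      (Metric.ball_subset_closedBall.trans
        (Metric.closedBall_subset_closedBall (by linarith))).trans hs
    have hd : ∀ i, ∀ z ∈ unitBall n, DifferentiableAt ℂ (F i) z := fun i z hz =>
      (hF i z hz).differentiableAt ((isOpen_unitBall n).mem_nhds hz)
    have hder : ∀ ε > 0, ∃ N, ∀ i ≥ N, ∀ j ≥ N, ∀ z ∈ Metric.ball z₀ (ρ / 2),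
        ‖fderiv ℂ (F i) z - fderiv ℂ (F j) z‖ ≤ ε := by
      intro ε hε
      obtain ⟨N, hN⟩ := h (ε * ρ / 4) (by positivity)
      refine ⟨N, fun i hi j hj z hz => ?_⟩
      have hzs : Metric.ball z (ρ / 2) ⊆ Metric.closedBall z₀ ρ := by
        refine Metric.ball_subset_closedBall.trans (Metric.closedBall_subset_closedBall' ?_)
        have : dist z z₀ < ρ / 2 := hz
        linarith
      have key := Complex.norm_fderiv_le_div_of_mapsTo_ball (f := F i - F j) (c := z)
        (R₁ := ρ / 2) (R₂ := ε * ρ / 2) (((hF i).sub (hF j)).mono (hzs.trans hs))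
        (fun w hw => by
          have h1 := hN i hi j hj w (hzs hw)
          have h2 := hN i hi j hj z (hzs (Metric.mem_ball_self (by positivity)))
          rw [Metric.mem_closedBall, dist_eq_norm]
          refine (norm_sub_le _ _).trans ?_
          simp only [Pi.sub_apply]
          linarith) (by positivity)
      rw [fderiv_sub (hd i z (hbs hz)) (hd j z (hbs hz))] at key
      refine key.trans (le_of_eq ?_)
      field_simp
    have hG' : ∀ z, ∃ L, z ∈ Metric.ball z₀ (ρ / 2) →
        Tendsto (fun i => fderiv ℂ (F i) z) atTop (𝓝 L) := by
      intro z
      by_cases hz : z ∈ Metric.ball z₀ (ρ / 2)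
      · have : CauchySeq fun i => fderiv ℂ (F i) z := by
          refine Metric.cauchySeq_iff.2 fun ε hε => ?_
          obtain ⟨N, hN⟩ := hder (ε / 2) (by positivity)
          refine ⟨N, fun i hi j hj => ?_⟩
          rw [dist_eq_norm]
          linarith [hN i hi j hj z hz]
        obtain ⟨y, hy⟩ := cauchySeq_tendsto_of_complete this
        exact ⟨y, fun _ => hy⟩
      · exact ⟨0, fun h => absurd h hz⟩
    choose G' hG' using hG'
    have hU : TendstoUniformlyOn (fun i => fderiv ℂ (F i)) G' atTop (Metric.ball z₀ (ρ / 2)) := by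
      refine UniformCauchySeqOn.tendstoUniformlyOn_of_tendsto ?_ hG'
      refine Metric.uniformCauchySeqOn_iff.2 fun ε hε => ?_
      obtain ⟨N, hN⟩ := hder (ε / 2) (by positivity)
      refine ⟨N, fun i hi j hj z hz => ?_⟩
      rw [dist_eq_norm]
      linarith [hN i hi j hj z hz]
    have := hasFDerivAt_of_tendstoUniformlyOn Metric.isOpen_ball hU
      (fun i z hz => (hd i z (hbs hz)).hasFDerivAt) (fun z hz => hG z (hbs hz))
      (Metric.mem_ball_self (by positivity))
    exact this.differentiableAt.differentiableWithinAt
  · obtain ⟨φ, hφ, hφt⟩ := (tendstoInMeasure_of_tendsto_Lp hfg).exists_seq_tendsto_ae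
    have hball : ∀ᵐ z ∂weightedVolume n, z ∈ unitBall n :=
      (weightedVolume_absolutelyContinuous n).ae_le
        (ae_restrict_mem (isOpen_unitBall n).measurableSet)
    filter_upwards [hφt, hball, ae_all_iff.2 hfF] with z h1 h2 h3
    refine tendsto_nhds_unique h1 ?_
    simp only [h3]
    exact (hG z h2).comp hφ.tendsto_atTop

instance (n : ℕ) : CompleteSpace (bergmanSpace n) :=
  (isClosed_bergmanSpace n).completeSpace_coe

/-- The weighted Bergman projection: the orthogonal projection of `L²(𝔹ⁿ, μ)` onto its closed
subspace `L²ₐ(𝔹ⁿ, μ)`. -/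
def bergmanProjection (n : ℕ) : WeightedL2 n →L[ℂ] WeightedL2 n :=
  (bergmanSpace n).starProjection

/-- `∂φ/∂zᵢ = (∂φ/∂xᵢ - i ∂φ/∂yᵢ) / 2`. -/
def dz {n : ℕ} (i : Fin n) (φ : (Fin n → ℂ) → ℂ) : (Fin n → ℂ) → ℂ := fun z =>
  (fderiv ℝ φ z (Pi.single i 1) - Complex.I * fderiv ℝ φ z (Pi.single i Complex.I)) / 2

/-- `∂φ/∂z̄ᵢ = (∂φ/∂xᵢ + i ∂φ/∂yᵢ) / 2`. -/
def dzbar {n : ℕ} (i : Fin n) (φ : (Fin n → ℂ) → ℂ) : (Fin n → ℂ) → ℂ := fun z =>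
  (fderiv ℝ φ z (Pi.single i 1) + Complex.I * fderiv ℝ φ z (Pi.single i Complex.I)) / 2

/-- The derivative `∂^{β+γ} φ / ∂z̄^β ∂z^γ` of a smooth function `φ`. -/
def wirtingerDeriv {n : ℕ} (β γ : Fin n → ℕ) (φ : (Fin n → ℂ) → ℂ) : (Fin n → ℂ) → ℂ :=
  (List.finRange n).foldr (fun i ψ => (dzbar i)^[β i] ψ)
    ((List.finRange n).foldr (fun i ψ => (dz i)^[γ i] ψ) φ)

/-- Smooth complex-valued test functions with compact support in the unit ball. -/
def IsTestFunction {n : ℕ} (φ : (Fin n → ℂ) → ℂ) : Prop :=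
  ContDiff ℝ ∞ φ ∧ HasCompactSupport φ ∧ tsupport φ ⊆ unitBall n

/-- `g = ∂^{β+γ} f / ∂z̄^β ∂z^γ` on the unit ball in the sense of distributions. -/
def IsWeakDeriv {n : ℕ} (β γ : Fin n → ℕ) (f g : WeightedL2 n) : Prop :=
  ∀ φ : (Fin n → ℂ) → ℂ, IsTestFunction φ →
    ∫ z in unitBall n, f z * wirtingerDeriv β γ φ z =
      (-1) ^ (∑ i, (β i + γ i)) * ∫ z in unitBall n, g z * φ z

/-- The pairs of multi-indices `(β, γ)` with `|β + γ| ≤ k`. -/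
def multiIndices (n k : ℕ) : Finset ((Fin n → ℕ) × (Fin n → ℕ)) :=
  ((Fintype.piFinset fun _ => Finset.range (k + 1)) ×ˢ
    (Fintype.piFinset fun _ => Finset.range (k + 1))).filter
      fun p => ∑ i, (p.1 i + p.2 i) ≤ k

/-- The finset `multiIndices n k` consists of exactly the pairs with `|β + γ| ≤ k`. -/
theorem mem_multiIndices {n k : ℕ} {p : (Fin n → ℕ) × (Fin n → ℕ)} :
    p ∈ multiIndices n k ↔ ∑ i, (p.1 i + p.2 i) ≤ k := by
  simp only [multiIndices, Finset.mem_filter, Finset.mem_product, Fintype.mem_piFinset,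
    Finset.mem_range, and_iff_right_iff_imp]
  intro h
  have : ∀ i, p.1 i + p.2 i ≤ k := fun i =>
    (Finset.single_le_sum (f := fun i => p.1 i + p.2 i) (fun _ _ => Nat.zero_le _)
      (Finset.mem_univ i)).trans h
  exact ⟨fun i => by have := this i; omega, fun i => by have := this i; omega⟩

/-- Membership in `W^k(𝔹ⁿ, μ)`: all weak derivatives of order at most `k` exist in
`L²(𝔹ⁿ, μ)`. -/
def MemSobolev {n : ℕ} (k : ℕ) (f : WeightedL2 n) : Prop :=
  ∀ p ∈ multiIndices n k, ∃ g : WeightedL2 n, IsWeakDeriv p.1 p.2 f g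

/-- Weak derivatives are unique. -/
theorem IsWeakDeriv.unique {n : ℕ} {β γ : Fin n → ℕ} {f g₁ g₂ : WeightedL2 n}
    (h₁ : IsWeakDeriv β γ f g₁) (h₂ : IsWeakDeriv β γ f g₂) : g₁ = g₂ := by
  have hloc : ∀ g : WeightedL2 n, ∀ K : Set (Fin n → ℂ), IsCompact K → K ⊆ unitBall n →
      IntegrableOn g K volume := by
    intro g K hK hKs
    obtain ⟨c, hc⟩ := exists_restrict_le hK hKs
    have : IsFiniteMeasure (volume.restrict K) := ⟨by simpa using hK.measure_lt_top⟩
    exact (((Lp.memLp g).smul_measure ENNReal.coe_ne_top).mono_measure hc).integrable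
      (by norm_num)
  have hint : ∀ (g : WeightedL2 n) (φ : (Fin n → ℂ) → ℂ), IsTestFunction φ →
      IntegrableOn (fun z => g z * φ z) (unitBall n) volume := by
    intro g φ hφ
    have h := (hloc g _ hφ.2.1 hφ.2.2).mul_continuousOn hφ.1.continuous.continuousOn hφ.2.1
    refine h.of_forall_sdiff_eq_zero (isOpen_unitBall n).measurableSet fun z hz => ?_
    simp [image_eq_zero_of_notMem_tsupport hz.2]
  have key : ∀ᵐ z ∂volume, z ∈ unitBall n → (g₁ z - g₂ z) = 0 := by
    refine (isOpen_unitBall n).ae_eq_zero_of_integral_contDiff_smul_eq_zero ?_ ?_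
    · rw [locallyIntegrableOn_iff (isOpen_unitBall n).isLocallyClosed]
      exact fun K hKs hK => (hloc g₁ K hK hKs).sub (hloc g₂ K hK hKs)
    · intro φ hφ hφc hφs
      set ψ : (Fin n → ℂ) → ℂ := fun z => (φ z : ℂ) with hψ
      have hts : tsupport ψ ⊆ tsupport φ := by
        refine closure_mono fun z hz => ?_
        simpa [hψ] using hz
      have hψt : IsTestFunction ψ :=
        ⟨Complex.ofRealCLM.contDiff.comp hφ, hφc.mono' (subset_closure.trans hts), hts.trans hφs⟩
      have e := (h₁ ψ hψt).symm.trans (h₂ ψ hψt)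
      have e' := mul_left_cancel₀ (pow_ne_zero _ (by norm_num)) e
      have e'' : ∫ z in unitBall n, φ z • (g₁ z - g₂ z) = 0 := by
        rw [← sub_eq_zero, ← integral_sub (hint g₁ ψ hψt) (hint g₂ ψ hψt)] at e'
        rw [← e']
        refine integral_congr_ae (Eventually.of_forall fun z => ?_)
        simp only [hψ, Complex.real_smul]
        ring
      rw [← e'']
      refine (setIntegral_eq_integral_of_forall_compl_eq_zero fun z hz => ?_).symm
      rw [image_eq_zero_of_notMem_tsupport fun h => hz (hφs h), zero_smul]
  refine Lp.ext ((weightedVolume_absolutelyContinuous n).ae_le ?_)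
  refine (ae_restrict_iff' (isOpen_unitBall n).measurableSet).2 ?_
  filter_upwards [key] with z hz hzb
  exact sub_eq_zero.1 (hz hzb)

open Classical in
/-- The weak derivative `∂^{β+γ} f / ∂z̄^β ∂z^γ` in `L²(𝔹ⁿ, μ)` (zero if there is none). -/
def weakDeriv {n : ℕ} (β γ : Fin n → ℕ) (f : WeightedL2 n) : WeightedL2 n :=
  if h : ∃ g : WeightedL2 n, IsWeakDeriv β γ f g then h.choose else 0

/-- The norm of `W^k(𝔹ⁿ, μ)`. -/
def sobolevNorm {n : ℕ} (k : ℕ) (f : WeightedL2 n) : ℝ :=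
  Real.sqrt (∑ p ∈ multiIndices n k,
    ∫ z, ‖weakDeriv p.1 p.2 f z‖ ^ 2 ∂(weightedVolume n))

end WeightedBergman

end

/-!
The weight is radial, so `𝐁` commutes with the rotations `z ↦ e^{iθ} z`, and everything can be
measured on homogeneous components. Let `Π_d` (`homogeneousPart`) be the orthogonal projection of
`L²(𝔹ⁿ, μ)` onto the homogeneous polynomials of degree `d`. These spaces are pairwise orthogonal
and `𝐁 f = ∑ Π_d f` (`hasSum_homogeneousPart`). Two estimates, one in each direction, balance.

* Decay of the components. The field `T = ∑ⱼ (zⱼ ∂/∂zⱼ - z̄ⱼ ∂/∂z̄ⱼ)`, which generates the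
  rotations, annihilates every radial function, so it can be integrated by parts against `μ`
  without error terms (`moment_rotation`). Hence `d Π_d f = Π_d (T f)`. As the coefficients of `T`
  are bounded, iteration bounds `∑ (1 + d)^{2k} ‖Π_d f‖²` by `‖f‖²_{k,μ}`
  (`exists_sum_homogeneousPart_le`). To iterate without differentiating the coefficients of `T`,
  the estimate is proved for all products `a b̄ f` with homogeneous polynomials `a` and `b`.

* Growth of derivatives. If `U` is the radial function with `∂U/∂zⱼ = -z̄ⱼ μ` that vanishes on the
  sphere, then `∂/∂zⱼ` with respect to `U` is adjoint to multiplication by `zⱼ` with respect to `μ`.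
  With Euler's identity this gives, for `q` homogeneous of degree `d`,
  `∑ⱼ ∫ |∂ⱼq|² U = d ∫ |q|² μ` and `∫ |z|² |q|² μ = (n + d) ∫ |q|² U`. The factor `|z|²` can be
  dropped up to a constant (`radialNormSq_le_add`), and so `‖∂ⱼq‖ = O((1 + d) ‖q‖)`.

Consequently `∂^γ 𝐁 f = ∑ ∂^γ Π_d f` converges in `L²(𝔹ⁿ, μ)` for `|γ| ≤ k`, while derivatives
involving some `∂/∂z̄ⱼ` vanish. That the polynomials exhaust the Bergman space is
`eq_zero_of_forall_inner_polyL2`: the Taylor coefficients of a holomorphic function along complex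
lines through the origin are homogeneous polynomials (`exists_isHomogeneous_taylor`), and they are
recovered by averaging over the circle action.
-/

noncomputable section

namespace WeightedBergman

open MeasureTheory Filter Topology
open scoped ContDiff ComplexConjugate

/-! ### Wirtinger calculus -/

/-- The first-order operator `(∂/∂xᵢ + c ∂/∂yᵢ) / 2`, which is `∂/∂zᵢ` for `c = -i` and `∂/∂z̄ᵢ`
for `c = i`. -/
def wirtingerOp {n : ℕ} (c : ℂ) (i : Fin n) (φ : (Fin n → ℂ) → ℂ) : (Fin n → ℂ) → ℂ := fun z =>
  (fderiv ℝ φ z (Pi.single i 1) + c * fderiv ℝ φ z (Pi.single i Complex.I)) / 2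

theorem dz_eq_wirtingerOp {n : ℕ} (i : Fin n) : dz i = wirtingerOp (-Complex.I) i := by
  funext φ z
  simp only [dz, wirtingerOp]
  ring

theorem dzbar_eq_wirtingerOp {n : ℕ} (i : Fin n) : dzbar i = wirtingerOp Complex.I i := rfl

section

variable {n : ℕ} {c c' : ℂ} {i j : Fin n} {φ ψ : (Fin n → ℂ) → ℂ} {z : Fin n → ℂ}

theorem wirtingerOp_add (hφ : DifferentiableAt ℝ φ z) (hψ : DifferentiableAt ℝ ψ z) :
    wirtingerOp c i (fun z => φ z + ψ z) z = wirtingerOp c i φ z + wirtingerOp c i ψ z := by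
  simp only [wirtingerOp, fderiv_fun_add hφ hψ, add_apply]
  ring

theorem wirtingerOp_mul (hφ : DifferentiableAt ℝ φ z) (hψ : DifferentiableAt ℝ ψ z) :
    wirtingerOp c i (fun z => φ z * ψ z) z =
      φ z * wirtingerOp c i ψ z + ψ z * wirtingerOp c i φ z := by
  simp only [wirtingerOp, fderiv_fun_mul hφ hψ, add_apply,
    smul_apply, smul_eq_mul]
  ring

theorem wirtingerOp_const (a : ℂ) : wirtingerOp c i (fun _ => a) z = 0 := by
  simp [wirtingerOp]

theorem wirtingerOp_conj (hφ : DifferentiableAt ℝ φ z) :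
    wirtingerOp c i (fun z => conj (φ z)) z = conj (wirtingerOp (conj c) i φ z) := by
  have h : HasFDerivAt (fun z => conj (φ z))
      ((Complex.conjCLE : ℂ →L[ℝ] ℂ).comp (fderiv ℝ φ z)) z :=
    (Complex.conjCLE : ℂ →L[ℝ] ℂ).hasFDerivAt.comp z hφ.hasFDerivAt
  simp only [wirtingerOp, h.fderiv, map_div₀, map_add, map_mul, Complex.conj_conj, map_ofNat]
  rfl

theorem contDiff_wirtingerOp (hφ : ContDiff ℝ ∞ φ) : ContDiff ℝ ∞ (wirtingerOp c i φ) := by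
  have h : ContDiff ℝ ∞ (fderiv ℝ φ) := hφ.fderiv_right le_rfl
  exact ((h.clm_apply contDiff_const).add
    (contDiff_const.mul (h.clm_apply contDiff_const))).div_const _

theorem support_wirtingerOp_subset : Function.support (wirtingerOp c i φ) ⊆ tsupport φ := by
  intro z hz
  by_contra h
  have : fderiv ℝ φ z = 0 := by
    by_contra h'
    exact h (support_fderiv_subset ℝ h')
  simp [wirtingerOp, this] at hz

theorem IsTestFunction.wirtingerOp (hφ : IsTestFunction φ) :
    IsTestFunction (wirtingerOp c i φ) := by
  have hs : tsupport (WeightedBergman.wirtingerOp c i φ) ⊆ tsupport φ :=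
    closure_minimal support_wirtingerOp_subset (isClosed_tsupport φ)
  exact ⟨contDiff_wirtingerOp hφ.1, hφ.2.1.mono' support_wirtingerOp_subset, hs.trans hφ.2.2⟩

/-- The constant-coefficient operators `∂/∂zᵢ`, `∂/∂z̄ᵢ` commute on smooth functions. -/
theorem wirtingerOp_comm (hφ : ContDiff ℝ ∞ φ) :
    wirtingerOp c i (wirtingerOp c' j φ) = wirtingerOp c' j (wirtingerOp c i φ) := by
  have hd : ∀ z, DifferentiableAt ℝ (fderiv ℝ φ) z := fun z =>
    ((hφ.fderiv_right (m := ∞) le_rfl).differentiable (by simp)) z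
  have key : ∀ (c : ℂ) (i : Fin n) (z v : Fin n → ℂ), fderiv ℝ (wirtingerOp c i φ) z v =
      (fderiv ℝ (fderiv ℝ φ) z v (Pi.single i 1) +
        c * fderiv ℝ (fderiv ℝ φ) z v (Pi.single i Complex.I)) / 2 := by
    intro c i z v
    have h1 : ∀ u : Fin n → ℂ, HasFDerivAt (fun z => fderiv ℝ φ z u)
        ((ContinuousLinearMap.apply ℝ ℂ u).comp (fderiv ℝ (fderiv ℝ φ) z)) z := fun u =>
      (ContinuousLinearMap.apply ℝ ℂ u).hasFDerivAt.comp z (hd z).hasFDerivAt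
    have h2 := ((h1 (Pi.single i 1)).add ((h1 (Pi.single i Complex.I)).const_mul c)).mul_const
      (2⁻¹ : ℂ)
    have h3 : wirtingerOp c i φ = fun z => (fderiv ℝ φ z (Pi.single i 1) +
        c * fderiv ℝ φ z (Pi.single i Complex.I)) * 2⁻¹ := by
      funext z
      rw [wirtingerOp, div_eq_mul_inv]
    rw [h3]
    refine (congrArg (fun L => L v) h2.fderiv).trans ?_
    simp
    ring
  funext z
  have hsym : ∀ u v, fderiv ℝ (fderiv ℝ φ) z u v = fderiv ℝ (fderiv ℝ φ) z v u := fun u v =>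
    (hφ.contDiffAt (x := z)).isSymmSndFDerivAt
      (by simpa using WithTop.coe_le_coe.2 (le_top : (2 : ℕ∞) ≤ ⊤)) u v
  simp only [wirtingerOp] at key ⊢
  rw [key, key, key, key, hsym (Pi.single j 1), hsym (Pi.single j 1), hsym (Pi.single j Complex.I),
    hsym (Pi.single j Complex.I)]
  ring

/-- Integration by parts. -/
theorem integral_mul_wirtingerOp (hφ : ContDiff ℝ 1 φ) (hψ : ContDiff ℝ 1 ψ)
    (hc : HasCompactSupport ψ) :
    ∫ z, φ z * wirtingerOp c i ψ z = -∫ z, wirtingerOp c i φ z * ψ z := by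
  have hφ' : Continuous (fderiv ℝ φ) := hφ.continuous_fderiv one_ne_zero
  have hψ' : Continuous (fderiv ℝ ψ) := hψ.continuous_fderiv one_ne_zero
  have i1 : ∀ v : Fin n → ℂ, Integrable (fun z => fderiv ℝ φ z v * ψ z) := fun v =>
    ((hφ'.clm_apply continuous_const).mul hψ.continuous).integrable_of_hasCompactSupport
      hc.mul_left
  have i2 : ∀ v : Fin n → ℂ, Integrable (fun z => φ z * fderiv ℝ ψ z v) := fun v =>
    (hφ.continuous.mul (hψ'.clm_apply continuous_const)).integrable_of_hasCompactSupport
      (hc.fderiv_apply ℝ v).mul_left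
  have i3 : Integrable (fun z => φ z * ψ z) :=
    (hφ.continuous.mul hψ.continuous).integrable_of_hasCompactSupport hc.mul_left
  have key : ∀ v : Fin n → ℂ, ∫ z, φ z * fderiv ℝ ψ z v = -∫ z, fderiv ℝ φ z v * ψ z := fun v =>
    integral_mul_fderiv_eq_neg_fderiv_mul_of_integrable (i1 v) (i2 v) i3
      (fun z _ => hφ.differentiable one_ne_zero z) (fun z _ => hψ.differentiable one_ne_zero z)
  have e1 : ∀ z, φ z * wirtingerOp c i ψ z = (φ z * fderiv ℝ ψ z (Pi.single i 1) +
      c * (φ z * fderiv ℝ ψ z (Pi.single i Complex.I))) / 2 := fun z => by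
    rw [wirtingerOp]; ring
  have e2 : ∀ z, wirtingerOp c i φ z * ψ z = (fderiv ℝ φ z (Pi.single i 1) * ψ z +
      c * (fderiv ℝ φ z (Pi.single i Complex.I) * ψ z)) / 2 := fun z => by
    rw [wirtingerOp]; ring
  simp_rw [e1, e2]
  rw [integral_div, integral_div, integral_add (i2 _) ((i2 _).const_mul c),
    integral_add (i1 _) ((i1 _).const_mul c), integral_const_mul, integral_const_mul, key, key]
  ring

end

/-! ### Iterated Wirtinger derivatives -/

section

variable {n : ℕ} {c c' : ℂ}

theorem contDiff_wirtingerOp_iterate (i : Fin n) (m : ℕ) {φ : (Fin n → ℂ) → ℂ}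
    (hφ : ContDiff ℝ ∞ φ) : ContDiff ℝ ∞ ((wirtingerOp c i)^[m] φ) := by
  induction m generalizing φ with
  | zero => exact hφ
  | succ m ih => exact ih (contDiff_wirtingerOp hφ)

theorem wirtingerOp_iterate_comm (i j : Fin n) (m : ℕ) {φ : (Fin n → ℂ) → ℂ}
    (hφ : ContDiff ℝ ∞ φ) :
    (wirtingerOp c i)^[m] (wirtingerOp c' j φ) = wirtingerOp c' j ((wirtingerOp c i)^[m] φ) := by
  induction m generalizing φ with
  | zero => rfl
  | succ m ih =>
    rw [Function.iterate_succ_apply, Function.iterate_succ_apply, wirtingerOp_comm hφ,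
      ih (contDiff_wirtingerOp hφ)]

theorem contDiff_foldr_wirtingerOp (l : List (Fin n)) (γ : Fin n → ℕ) {φ : (Fin n → ℂ) → ℂ}
    (hφ : ContDiff ℝ ∞ φ) :
    ContDiff ℝ ∞ (l.foldr (fun i ψ => (wirtingerOp c i)^[γ i] ψ) φ) := by
  induction l with
  | nil => exact hφ
  | cons i l ih => exact contDiff_wirtingerOp_iterate i _ ih

theorem foldr_wirtingerOp_comm (l : List (Fin n)) (γ : Fin n → ℕ) (j : Fin n)
    {φ : (Fin n → ℂ) → ℂ} (hφ : ContDiff ℝ ∞ φ) :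
    l.foldr (fun i ψ => (wirtingerOp c i)^[γ i] ψ) (wirtingerOp c' j φ) =
      wirtingerOp c' j (l.foldr (fun i ψ => (wirtingerOp c i)^[γ i] ψ) φ) := by
  induction l with
  | nil => rfl
  | cons i l ih =>
    rw [List.foldr_cons, List.foldr_cons, ih,
      wirtingerOp_iterate_comm _ _ _ (contDiff_foldr_wirtingerOp l γ hφ)]

theorem foldr_wirtingerOp_add_single (l : List (Fin n)) (hl : l.Nodup) (γ : Fin n → ℕ) (j : Fin n)
    {φ : (Fin n → ℂ) → ℂ} (hφ : ContDiff ℝ ∞ φ) :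
    l.foldr (fun i ψ => (wirtingerOp c i)^[(γ + Pi.single j 1 : Fin n → ℕ) i] ψ) φ =
      if j ∈ l then l.foldr (fun i ψ => (wirtingerOp c i)^[γ i] ψ) (wirtingerOp c j φ)
      else l.foldr (fun i ψ => (wirtingerOp c i)^[γ i] ψ) φ := by
  induction l with
  | nil => rfl
  | cons i l ih =>
    rw [List.nodup_cons] at hl
    rw [List.foldr_cons, ih hl.2]
    by_cases hij : j = i
    · subst hij
      simp only [hl.1, if_false, List.mem_cons, true_or, if_true, List.foldr_cons, Pi.add_apply,
        Pi.single_eq_same, Function.iterate_succ_apply]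
      rw [foldr_wirtingerOp_comm l γ j hφ]
    · simp [hij, Ne.symm hij]
      split_ifs <;> rfl

theorem foldr_wirtingerOp_zero (l : List (Fin n)) (φ : (Fin n → ℂ) → ℂ) :
    l.foldr (fun i ψ => (wirtingerOp c i)^[(0 : Fin n → ℕ) i] ψ) φ = φ := by
  induction l with
  | nil => rfl
  | cons i l ih => exact ih

theorem wirtingerDeriv_zero (φ : (Fin n → ℂ) → ℂ) : wirtingerDeriv 0 0 φ = φ := by
  simp only [wirtingerDeriv, dz_eq_wirtingerOp, dzbar_eq_wirtingerOp, foldr_wirtingerOp_zero]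

theorem wirtingerDeriv_add_single_right (β γ : Fin n → ℕ) (j : Fin n) {φ : (Fin n → ℂ) → ℂ}
    (hφ : ContDiff ℝ ∞ φ) :
    wirtingerDeriv β (γ + Pi.single j 1) φ = wirtingerDeriv β γ (dz j φ) := by
  simp only [wirtingerDeriv, dz_eq_wirtingerOp]
  rw [foldr_wirtingerOp_add_single _ (List.nodup_finRange n) γ j hφ,
    if_pos (List.mem_finRange j)]

theorem wirtingerDeriv_add_single_left (β γ : Fin n → ℕ) (j : Fin n) {φ : (Fin n → ℂ) → ℂ}
    (hφ : ContDiff ℝ ∞ φ) :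
    wirtingerDeriv (β + Pi.single j 1) γ φ = wirtingerDeriv β γ (dzbar j φ) := by
  simp only [wirtingerDeriv, dzbar_eq_wirtingerOp, dz_eq_wirtingerOp]
  rw [foldr_wirtingerOp_add_single _ (List.nodup_finRange n) β j
    (contDiff_foldr_wirtingerOp _ _ hφ), if_pos (List.mem_finRange j),
    foldr_wirtingerOp_comm _ _ _ hφ]

theorem dz_wirtingerDeriv (β γ : Fin n → ℕ) (j : Fin n) {φ : (Fin n → ℂ) → ℂ}
    (hφ : ContDiff ℝ ∞ φ) : dz j (wirtingerDeriv β γ φ) = wirtingerDeriv β γ (dz j φ) := by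
  simp only [wirtingerDeriv, dzbar_eq_wirtingerOp, dz_eq_wirtingerOp]
  rw [foldr_wirtingerOp_comm _ _ _ hφ,
    foldr_wirtingerOp_comm _ _ _ (contDiff_foldr_wirtingerOp _ _ hφ)]

theorem dzbar_wirtingerDeriv (β γ : Fin n → ℕ) (j : Fin n) {φ : (Fin n → ℂ) → ℂ}
    (hφ : ContDiff ℝ ∞ φ) : dzbar j (wirtingerDeriv β γ φ) = wirtingerDeriv β γ (dzbar j φ) := by
  simp only [wirtingerDeriv, dzbar_eq_wirtingerOp, dz_eq_wirtingerOp]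
  rw [foldr_wirtingerOp_comm _ _ _ hφ,
    foldr_wirtingerOp_comm _ _ _ (contDiff_foldr_wirtingerOp _ _ hφ)]

theorem IsTestFunction.wirtingerDeriv (β γ : Fin n → ℕ) {φ : (Fin n → ℂ) → ℂ}
    (hφ : IsTestFunction φ) : IsTestFunction (wirtingerDeriv β γ φ) := by
  have key : ∀ (c : ℂ) (γ : Fin n → ℕ) (l : List (Fin n)) {φ : (Fin n → ℂ) → ℂ},
      IsTestFunction φ →
        IsTestFunction (l.foldr (fun i ψ => (WeightedBergman.wirtingerOp c i)^[γ i] ψ) φ) := by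
    intro c γ l φ hφ
    induction l with
    | nil => exact hφ
    | cons i l ih =>
      rw [List.foldr_cons]
      generalize γ i = m
      induction m with
      | zero => exact ih
      | succ m ih' =>
        rw [Function.iterate_succ_apply']
        exact ih'.wirtingerOp
  simp only [WeightedBergman.wirtingerDeriv, dzbar_eq_wirtingerOp, dz_eq_wirtingerOp]
  exact key _ _ _ (key _ _ _ hφ)

end

/-! ### Derivatives of polynomials and of radial functions -/

section

variable {n : ℕ} (q : MvPolynomial (Fin n) ℂ) (i : Fin n) (z : Fin n → ℂ)

theorem contDiff_eval : ContDiff ℝ ∞ fun z => MvPolynomial.eval z q :=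
  ((contDiff_omega_iff_analyticOnNhd.2
    (AnalyticOnNhd.eval_mvPolynomial q) : ContDiff ℂ ω _).restrict_scalars ℝ).of_le le_top

theorem differentiable_eval : Differentiable ℝ fun z => MvPolynomial.eval z q :=
  (contDiff_eval q).differentiable (by simp)

theorem wirtingerOp_coord (c : ℂ) (i j : Fin n) :
    wirtingerOp c i (fun z => z j) z = if i = j then (1 + c * Complex.I) / 2 else 0 := by
  have h : HasFDerivAt (fun z : Fin n → ℂ => z j)
    (ContinuousLinearMap.proj (R := ℝ) (φ := fun _ : Fin n => ℂ) j) z :=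
    (ContinuousLinearMap.proj (R := ℝ) (φ := fun _ : Fin n => ℂ) j).hasFDerivAt
  rw [wirtingerOp, h.fderiv]
  by_cases hij : i = j
  · subst hij; simp
  · simp [hij]

theorem wirtingerOp_eval (c : ℂ) :
    wirtingerOp c i (fun z => MvPolynomial.eval z q) z =
      (1 + c * Complex.I) / 2 * MvPolynomial.eval z (MvPolynomial.pderiv i q) := by
  induction q using MvPolynomial.induction_on with
  | C a => simp [wirtingerOp_const]
  | add p q hp hq =>
    simp only [map_add]
    rw [wirtingerOp_add (differentiable_eval p z) (differentiable_eval q z), hp, hq]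
    ring
  | mul_X p j hp =>
    simp only [map_mul, MvPolynomial.eval_X, Derivation.leibniz, MvPolynomial.pderiv_X, smul_eq_mul,
      map_add]
    rw [wirtingerOp_mul (differentiable_eval p z) (by fun_prop), hp, wirtingerOp_coord]
    by_cases hij : i = j
    · subst hij; simp; ring
    · simp [hij]; ring

theorem dz_eval : dz i (fun z => MvPolynomial.eval z q) z =
    MvPolynomial.eval z (MvPolynomial.pderiv i q) := by
  rw [dz_eq_wirtingerOp, wirtingerOp_eval]
  simp

theorem dzbar_eval : dzbar i (fun z => MvPolynomial.eval z q) z = 0 := by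
  rw [dzbar_eq_wirtingerOp, wirtingerOp_eval]
  simp

theorem dz_conj_eval : dz i (fun z => conj (MvPolynomial.eval z q)) z = 0 := by
  rw [dz_eq_wirtingerOp, wirtingerOp_conj (differentiable_eval q z), wirtingerOp_eval]
  simp

theorem dzbar_conj_eval : dzbar i (fun z => conj (MvPolynomial.eval z q)) z =
    conj (MvPolynomial.eval z (MvPolynomial.pderiv i q)) := by
  rw [dzbar_eq_wirtingerOp, wirtingerOp_conj (differentiable_eval q z), wirtingerOp_eval]
  simp

theorem contDiff_radial {m : ℕ∞} {h : ℝ → ℝ} (hh : ContDiff ℝ m h) :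
    ContDiff ℝ m fun z : Fin n → ℂ => ((h (1 - ∑ i, ‖z i‖ ^ 2) : ℝ) : ℂ) := by
  refine Complex.ofRealCLM.contDiff.comp (hh.comp (contDiff_const.sub (ContDiff.sum fun i _ => ?_)))
  exact (contDiff_apply ℝ ℂ i).norm_sq ℝ

theorem wirtingerOp_radial (c : ℂ) {h : ℝ → ℝ} {h' : ℝ} {z : Fin n → ℂ}
    (hh : HasDerivAt h h' (1 - ∑ i, ‖z i‖ ^ 2)) :
    wirtingerOp c i (fun z => ((h (1 - ∑ i, ‖z i‖ ^ 2) : ℝ) : ℂ)) z =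
      -h' * ((z i).re + c * (z i).im) := by
  have h1 : ∀ j : Fin n, HasFDerivAt (fun z : Fin n → ℂ => ‖z j‖ ^ 2)
      (((2 : ℝ) • innerSL ℝ (z j)).comp
        (ContinuousLinearMap.proj (R := ℝ) (φ := fun _ : Fin n => ℂ) j)) z := fun j => by
    have := (hasStrictFDerivAt_norm_sq (z j)).hasFDerivAt.comp z
      (ContinuousLinearMap.proj (R := ℝ) (φ := fun _ : Fin n => ℂ) j).hasFDerivAt
    rwa [ofNat_smul_eq_nsmul]
  have h2 := (HasFDerivAt.fun_sum fun j (_ : j ∈ Finset.univ) => h1 j).const_sub 1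
  have h3 := Complex.ofRealCLM.hasFDerivAt.comp z (hh.comp_hasFDerivAt z h2)
  have h4 : fderiv ℝ (fun z : Fin n → ℂ => ((h (1 - ∑ i, ‖z i‖ ^ 2) : ℝ) : ℂ)) z = _ := h3.fderiv
  have hs : ∀ a : ℂ, ∑ x, inner ℝ (z x) (Pi.single (M := fun _ : Fin n => ℂ) i a x) =
      inner ℝ (z i) a := fun a => by
    rw [Finset.sum_eq_single i]
    · simp
    · intro b _ hb
      simp [Pi.single_eq_of_ne hb]
    · simp
  rw [wirtingerOp, h4]
  have h5 : ∀ a : ℂ, (Complex.ofRealCLM.comp (h' • -∑ j, ((2 : ℝ) • innerSL ℝ (z j)).comp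
      (ContinuousLinearMap.proj (R := ℝ) (φ := fun _ : Fin n => ℂ) j)))
        (Pi.single (M := fun _ : Fin n => ℂ) i a) = ((h' * -(2 * inner ℝ (z i) a) : ℝ) : ℂ) := by
    intro a
    rw [← hs a, Finset.mul_sum]
    simp
  rw [h5, h5]
  simp [Complex.inner]
  ring

theorem dz_radial {h : ℝ → ℝ} {h' : ℝ} {z : Fin n → ℂ}
    (hh : HasDerivAt h h' (1 - ∑ i, ‖z i‖ ^ 2)) :
    dz i (fun z => ((h (1 - ∑ i, ‖z i‖ ^ 2) : ℝ) : ℂ)) z = -h' * conj (z i) := by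
  rw [dz_eq_wirtingerOp, wirtingerOp_radial i _ hh]
  congr 1
  apply Complex.ext <;> simp

theorem dzbar_radial {h : ℝ → ℝ} {h' : ℝ} {z : Fin n → ℂ}
    (hh : HasDerivAt h h' (1 - ∑ i, ‖z i‖ ^ 2)) :
    dzbar i (fun z => ((h (1 - ∑ i, ‖z i‖ ^ 2) : ℝ) : ℂ)) z = -h' * z i := by
  rw [dzbar_eq_wirtingerOp, wirtingerOp_radial i _ hh]
  congr 1
  apply Complex.ext <;> simp

end

/-! ### Polynomials paired against radial weights -/

/-- The primitive of `expNegInvGlue` that vanishes on the negative half-line. -/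
def gluePrimitive (t : ℝ) : ℝ := ∫ s in (0 : ℝ)..t, expNegInvGlue s

theorem continuous_expNegInvGlue : Continuous expNegInvGlue :=
  (expNegInvGlue.contDiff (n := 0)).continuous

theorem expNegInvGlue_le_one (t : ℝ) : expNegInvGlue t ≤ 1 := by
  rw [expNegInvGlue]
  split_ifs with h
  · exact zero_le_one
  · rw [Real.exp_le_one_iff, neg_nonpos, inv_nonneg]
    linarith

theorem hasDerivAt_gluePrimitive (t : ℝ) : HasDerivAt gluePrimitive (expNegInvGlue t) t :=
  (continuous_expNegInvGlue.integral_hasStrictDerivAt 0 t).hasDerivAt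

theorem contDiff_gluePrimitive : ContDiff ℝ 1 gluePrimitive := by
  rw [contDiff_one_iff_deriv]
  refine ⟨fun t => (hasDerivAt_gluePrimitive t).differentiableAt, ?_⟩
  rw [funext fun t => (hasDerivAt_gluePrimitive t).deriv]
  exact continuous_expNegInvGlue

theorem gluePrimitive_of_nonpos {t : ℝ} (ht : t ≤ 0) : gluePrimitive t = 0 := by
  rw [gluePrimitive, intervalIntegral.integral_symm, neg_eq_zero]
  refine intervalIntegral.integral_zero_ae (Eventually.of_forall fun s hs => ?_)
  rw [Set.uIoc_of_le ht] at hs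
  exact expNegInvGlue.zero_of_nonpos hs.2

theorem monotone_gluePrimitive : Monotone gluePrimitive :=
  monotone_of_hasDerivAt_nonneg hasDerivAt_gluePrimitive fun t => expNegInvGlue.nonneg t

theorem gluePrimitive_nonneg (t : ℝ) : 0 ≤ gluePrimitive t := by
  rw [← gluePrimitive_of_nonpos (min_le_right t 0)]
  exact monotone_gluePrimitive (min_le_left _ _)

theorem gluePrimitive_pos {t : ℝ} (ht : 0 < t) : 0 < gluePrimitive t :=
  intervalIntegral.intervalIntegral_pos_of_pos_on
    (continuous_expNegInvGlue.intervalIntegrable _ _)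
    (fun _ hs => expNegInvGlue.pos_of_pos hs.1) ht

section

variable {n : ℕ}

theorem hasCompactSupport_radial {h : ℝ → ℝ} (hh : ∀ t ≤ 0, h t = 0) :
    HasCompactSupport fun z : Fin n → ℂ => ((h (1 - ∑ i, ‖z i‖ ^ 2) : ℝ) : ℂ) := by
  refine HasCompactSupport.intro (isCompact_closedBall (0 : Fin n → ℂ) 1) fun z hz => ?_
  have : ∃ i, 1 < ‖z i‖ := by
    by_contra! hc
    exact hz (mem_closedBall_zero_iff.2 ((pi_norm_le_iff_of_nonneg zero_le_one).2 hc))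
  obtain ⟨i, hi⟩ := this
  have h1 : ‖z i‖ ^ 2 ≤ ∑ i, ‖z i‖ ^ 2 :=
    Finset.single_le_sum (f := fun i => ‖z i‖ ^ 2) (fun _ _ => by positivity) (Finset.mem_univ i)
  rw [hh, Complex.ofReal_zero]
  nlinarith

/-- The pairing `∫ q r̄ h(1 - |z|²) dV` of two polynomials. -/
def radialPairing (h : ℝ → ℝ) (q r : MvPolynomial (Fin n) ℂ) : ℂ :=
  ∫ z : Fin n → ℂ, MvPolynomial.eval z q *
    (conj (MvPolynomial.eval z r) * ((h (1 - ∑ i, ‖z i‖ ^ 2) : ℝ) : ℂ))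

theorem integrable_radialPairing {h : ℝ → ℝ} (hc : Continuous h) (hh : ∀ t ≤ 0, h t = 0)
    (q r : MvPolynomial (Fin n) ℂ) :
    Integrable fun z : Fin n → ℂ => MvPolynomial.eval z q *
      (conj (MvPolynomial.eval z r) * ((h (1 - ∑ i, ‖z i‖ ^ 2) : ℝ) : ℂ)) := by
  refine Continuous.integrable_of_hasCompactSupport ?_
    (hasCompactSupport_radial hh).mul_left.mul_left
  have := MvPolynomial.continuous_eval q
  have := MvPolynomial.continuous_eval r
  fun_prop

/-- The squared norm `∫ |q|² h(1 - |z|²) dV`. -/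
def radialNormSq (h : ℝ → ℝ) (q : MvPolynomial (Fin n) ℂ) : ℝ :=
  ∫ z : Fin n → ℂ, ‖MvPolynomial.eval z q‖ ^ 2 * h (1 - ∑ i, ‖z i‖ ^ 2)

theorem integrable_radialNormSq {h : ℝ → ℝ} (hc : Continuous h) (hh : ∀ t ≤ 0, h t = 0)
    (q : MvPolynomial (Fin n) ℂ) :
    Integrable fun z : Fin n → ℂ => ‖MvPolynomial.eval z q‖ ^ 2 * h (1 - ∑ i, ‖z i‖ ^ 2) := by
  refine ((integrable_radialPairing hc hh q q).re).congr (Eventually.of_forall fun z => ?_)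
  simp only [← mul_assoc, Complex.mul_conj, Complex.normSq_eq_norm_sq]
  norm_cast

theorem radialPairing_self (h : ℝ → ℝ) (q : MvPolynomial (Fin n) ℂ) :
    radialPairing h q q = radialNormSq h q := by
  rw [radialPairing, radialNormSq, ← integral_complex_ofReal]
  congr 1
  funext z
  rw [← mul_assoc, Complex.mul_conj, Complex.normSq_eq_norm_sq]
  norm_cast

theorem radialPairing_sum_left {ι : Type*} {h : ℝ → ℝ} (hc : Continuous h)
    (hh : ∀ t ≤ 0, h t = 0) (s : Finset ι) (q : ι → MvPolynomial (Fin n) ℂ)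
    (r : MvPolynomial (Fin n) ℂ) :
    radialPairing h (∑ i ∈ s, q i) r = ∑ i ∈ s, radialPairing h (q i) r := by
  simp only [radialPairing]
  rw [← integral_finsetSum _ fun i _ => integrable_radialPairing hc hh (q i) r]
  simp only [map_sum, Finset.sum_mul]

theorem radialPairing_sum_right {ι : Type*} {h : ℝ → ℝ} (hc : Continuous h)
    (hh : ∀ t ≤ 0, h t = 0) (s : Finset ι) (q : MvPolynomial (Fin n) ℂ)
    (r : ι → MvPolynomial (Fin n) ℂ) :
    radialPairing h q (∑ i ∈ s, r i) = ∑ i ∈ s, radialPairing h q (r i) := by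
  simp only [radialPairing]
  rw [← integral_finsetSum _ fun i _ => integrable_radialPairing hc hh q (r i)]
  simp only [map_sum, Finset.sum_mul, Finset.mul_sum]

theorem radialPairing_nsmul_left (h : ℝ → ℝ) (m : ℕ) (q r : MvPolynomial (Fin n) ℂ) :
    radialPairing h (m • q) r = m * radialPairing h q r := by
  simp only [radialPairing, ← integral_const_mul]
  congr 1
  funext z
  simp
  ring

theorem radialPairing_nsmul_right (h : ℝ → ℝ) (m : ℕ) (q r : MvPolynomial (Fin n) ℂ) :
    radialPairing h q (m • r) = m * radialPairing h q r := by
  simp only [radialPairing, ← integral_const_mul]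
  congr 1
  funext z
  simp
  ring

/-- With respect to a radial weight and its primitive, `∂/∂zⱼ` is adjoint to multiplication by
`zⱼ`. -/
theorem radialPairing_pderiv {h H : ℝ → ℝ} (hH : ContDiff ℝ 1 H) (hH0 : ∀ t ≤ 0, H t = 0)
    (hd : ∀ t, HasDerivAt H (h t) t) (j : Fin n) (q r : MvPolynomial (Fin n) ℂ) :
    radialPairing H (MvPolynomial.pderiv j q) r = radialPairing h q (MvPolynomial.X j * r) := by
  have hr : ContDiff ℝ ∞ fun z : Fin n → ℂ => conj (MvPolynomial.eval z r) :=
    (Complex.conjCLE : ℂ →L[ℝ] ℂ).contDiff.comp (contDiff_eval r)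
  have hU := contDiff_radial (n := n) (m := 1) hH
  have h1 := integral_mul_wirtingerOp (c := -Complex.I) (i := j)
    ((contDiff_eval q).of_le (by simp))
    ((hr.of_le (m := 1) (by simp)).mul hU)
    (hasCompactSupport_radial hH0).mul_left
  simp only [← dz_eq_wirtingerOp, dz_eval] at h1
  rw [radialPairing, radialPairing, ← neg_eq_iff_eq_neg.2 h1, ← integral_neg]
  refine integral_congr_ae (Eventually.of_forall fun z => ?_)
  beta_reduce
  rw [dz_eq_wirtingerOp, wirtingerOp_mul (hr.differentiable (by simp) z)
    (hU.differentiable one_ne_zero z), ← dz_eq_wirtingerOp, dz_conj_eval, dz_radial j (hd _)]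
  simp only [map_mul, MvPolynomial.eval_X]
  ring

theorem sum_radialNormSq_pderiv {q : MvPolynomial (Fin n) ℂ} {d : ℕ} (hq : q.IsHomogeneous d) :
    ∑ j, radialNormSq gluePrimitive (MvPolynomial.pderiv j q) =
      d * radialNormSq expNegInvGlue q := by
  have h : ∑ j, radialPairing gluePrimitive (MvPolynomial.pderiv j q) (MvPolynomial.pderiv j q) =
      d * radialPairing expNegInvGlue q q := by
    simp_rw [radialPairing_pderiv contDiff_gluePrimitive (fun _ => gluePrimitive_of_nonpos)
      hasDerivAt_gluePrimitive]
    rw [← radialPairing_sum_right continuous_expNegInvGlue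
      (fun _ => expNegInvGlue.zero_of_nonpos), hq.sum_X_mul_pderiv, radialPairing_nsmul_right]
  simp only [radialPairing_self] at h
  exact_mod_cast h

theorem sum_radialNormSq_X_mul {q : MvPolynomial (Fin n) ℂ} {d : ℕ} (hq : q.IsHomogeneous d) :
    ∑ j, radialNormSq expNegInvGlue (MvPolynomial.X j * q) =
      (n + d : ℕ) * radialNormSq gluePrimitive q := by
  have h : ∑ j, radialPairing expNegInvGlue (MvPolynomial.X j * q) (MvPolynomial.X j * q) =
      (n + d : ℕ) * radialPairing gluePrimitive q q := by
    simp_rw [← radialPairing_pderiv contDiff_gluePrimitive (fun _ => gluePrimitive_of_nonpos)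
      hasDerivAt_gluePrimitive]
    rw [← radialPairing_sum_left contDiff_gluePrimitive.continuous
      (fun _ => gluePrimitive_of_nonpos), ← radialPairing_nsmul_left]
    congr 1
    simp only [Derivation.leibniz, MvPolynomial.pderiv_X_self, smul_eq_mul, mul_one,
      Finset.sum_add_distrib, hq.sum_X_mul_pderiv]
    simp [add_smul, add_comm]
  simp only [radialPairing_self] at h
  exact_mod_cast h

theorem radialNormSq_nonneg {h : ℝ → ℝ} (hh : ∀ t, 0 ≤ h t) (q : MvPolynomial (Fin n) ℂ) :
    0 ≤ radialNormSq h q :=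
  integral_nonneg fun _ => mul_nonneg (by positivity) (hh _)

/-- Where `|z|² ≥ 1/2` the weight is at most `2|z|²` times itself; elsewhere it is bounded by a
multiple of its primitive, which is bounded below there. -/
theorem radialNormSq_le_add (q : MvPolynomial (Fin n) ℂ) :
    radialNormSq expNegInvGlue q ≤ (gluePrimitive (1 / 2))⁻¹ * radialNormSq gluePrimitive q +
      2 * ∑ j, radialNormSq expNegInvGlue (MvPolynomial.X j * q) := by
  have iw := fun q : MvPolynomial (Fin n) ℂ => integrable_radialNormSq continuous_expNegInvGlue
    (fun _ => expNegInvGlue.zero_of_nonpos) q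
  have iU := integrable_radialNormSq contDiff_gluePrimitive.continuous
    (fun _ => gluePrimitive_of_nonpos) q
  have hM : 0 < gluePrimitive (1 / 2) := gluePrimitive_pos (by norm_num)
  simp only [radialNormSq]
  rw [← integral_finsetSum _ fun j _ => iw _, ← integral_const_mul, ← integral_const_mul,
    ← integral_add (iU.const_mul _) ((integrable_finsetSum _ fun j _ => iw _).const_mul _)]
  refine integral_mono (iw q)
    ((iU.const_mul _).add ((integrable_finsetSum _ fun j _ => iw _).const_mul _)) fun z => ?_
  simp only [map_mul, MvPolynomial.eval_X, norm_mul, mul_pow, mul_assoc]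
  rw [← Finset.sum_mul]
  set ρ := ∑ i, ‖z i‖ ^ 2
  have hw := expNegInvGlue.nonneg (1 - ρ)
  have hρ : 0 ≤ ρ := Finset.sum_nonneg fun _ _ => by positivity
  have hq : 0 ≤ ‖MvPolynomial.eval z q‖ ^ 2 := by positivity
  have hU := gluePrimitive_nonneg (1 - ρ)
  have key : expNegInvGlue (1 - ρ) ≤
      (gluePrimitive (1 / 2))⁻¹ * gluePrimitive (1 - ρ) + 2 * (ρ * expNegInvGlue (1 - ρ)) := by
    rcases le_total ρ (1 / 2) with h | h
    · have h1 : gluePrimitive (1 / 2) ≤ gluePrimitive (1 - ρ) :=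
        monotone_gluePrimitive (by linarith)
      have h2 : 1 ≤ (gluePrimitive (1 / 2))⁻¹ * gluePrimitive (1 - ρ) := by
        rw [inv_mul_eq_div, one_le_div hM]
        exact h1
      have := expNegInvGlue_le_one (1 - ρ)
      have : 0 ≤ ρ * expNegInvGlue (1 - ρ) := by positivity
      linarith
    · have : 0 ≤ (gluePrimitive (1 / 2))⁻¹ * gluePrimitive (1 - ρ) := by positivity
      nlinarith
  calc _ ≤ ‖MvPolynomial.eval z q‖ ^ 2 * ((gluePrimitive (1 / 2))⁻¹ * gluePrimitive (1 - ρ) +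
        2 * (ρ * expNegInvGlue (1 - ρ))) := mul_le_mul_of_nonneg_left key hq
    _ = _ := by ring

/-- The gradient of a homogeneous polynomial of degree `d` is bounded by `O(1 + d)` times the
polynomial itself. -/
theorem radialNormSq_pderiv_le (hn : 1 ≤ n) {q : MvPolynomial (Fin n) ℂ} {d : ℕ}
    (hq : q.IsHomogeneous d) (j : Fin n) :
    radialNormSq expNegInvGlue (MvPolynomial.pderiv j q) ≤
      ((gluePrimitive (1 / 2))⁻¹ + 2) * n * (1 + d) ^ 2 * radialNormSq expNegInvGlue q := by
  have hM : 0 < gluePrimitive (1 / 2) := gluePrimitive_pos (by norm_num)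
  have hU := fun q : MvPolynomial (Fin n) ℂ => radialNormSq_nonneg gluePrimitive_nonneg q
  have hn' : (1 : ℝ) ≤ n := by exact_mod_cast hn
  have hq' := hq.pderiv (i := j)
  set p := MvPolynomial.pderiv j q with hp
  have h1 := radialNormSq_le_add p
  have h2 := sum_radialNormSq_X_mul hq'
  have h3 : radialNormSq gluePrimitive p ≤ d * radialNormSq expNegInvGlue q := by
    rw [← sum_radialNormSq_pderiv hq]
    exact Finset.single_le_sum (f := fun j => radialNormSq gluePrimitive (MvPolynomial.pderiv j q))
      (fun _ _ => hU _) (Finset.mem_univ j)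
  have hw := radialNormSq_nonneg expNegInvGlue.nonneg q
  have h4 : (((n + (d - 1) : ℕ)) : ℝ) ≤ n * (1 + d) := by
    have h5 : (((n + (d - 1) : ℕ)) : ℝ) ≤ n + d := by exact_mod_cast (by omega)
    nlinarith [(Nat.cast_nonneg d : (0 : ℝ) ≤ d)]
  have h6 : (1 : ℝ) ≤ n * (1 + d) := by nlinarith [(Nat.cast_nonneg d : (0 : ℝ) ≤ d)]
  set K := (gluePrimitive (1 / 2))⁻¹ with hK
  have hK0 : 0 < K := inv_pos.2 hM
  rw [h2] at h1
  have hUp := hU p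
  have h7 : radialNormSq expNegInvGlue p ≤
      (K + 2) * (n * (1 + d)) * radialNormSq gluePrimitive p := by
    have e1 : K * radialNormSq gluePrimitive p ≤
        K * ((n * (1 + d)) * radialNormSq gluePrimitive p) :=
      mul_le_mul_of_nonneg_left (by nlinarith) hK0.le
    have e2 : ((n + (d - 1) : ℕ) : ℝ) * radialNormSq gluePrimitive p ≤
      (n * (1 + d)) * radialNormSq gluePrimitive p := mul_le_mul_of_nonneg_right h4 hUp
    linarith
  refine h7.trans ?_
  calc (K + 2) * (n * (1 + d)) * radialNormSq gluePrimitive p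
      ≤ (K + 2) * (n * (1 + d)) * ((1 + d) * radialNormSq expNegInvGlue q) := by
        refine mul_le_mul_of_nonneg_left (h3.trans ?_) (by positivity)
        nlinarith
    _ = _ := by ring

end

/-! ### Polynomials in the weighted space -/

section

variable {n : ℕ}

theorem weight_eq_of_mem {z : Fin n → ℂ} (hz : z ∈ unitBall n) :
    weight z = expNegInvGlue (1 - ∑ i, ‖z i‖ ^ 2) := by
  have h : ∑ i, ‖z i‖ ^ 2 < 1 := hz
  rw [weight, expNegInvGlue, if_neg (by linarith)]
  congr 1
  rw [← neg_sub, one_div, inv_neg]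

theorem expNegInvGlue_eq_zero_of_notMem {z : Fin n → ℂ} (hz : z ∉ unitBall n) :
    expNegInvGlue (1 - ∑ i, ‖z i‖ ^ 2) = 0 :=
  expNegInvGlue.zero_of_nonpos (by simpa [unitBall] using hz)

/-- The weight extended by zero is the smooth function `expNegInvGlue (1 - |z|²)` on `ℂⁿ`. -/
theorem weightedVolume_eq (n : ℕ) : weightedVolume n =
    volume.withDensity fun z : Fin n → ℂ =>
      ENNReal.ofReal (expNegInvGlue (1 - ∑ i, ‖z i‖ ^ 2)) := by
  rw [weightedVolume, ← withDensity_indicator (isOpen_unitBall n).measurableSet]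
  congr 1
  funext z
  by_cases hz : z ∈ unitBall n
  · rw [Set.indicator_of_mem hz, weight_eq_of_mem hz]
  · rw [Set.indicator_of_notMem hz, expNegInvGlue_eq_zero_of_notMem hz, ENNReal.ofReal_zero]

theorem measurable_ofReal_expNegInvGlue : Measurable fun z : Fin n → ℂ =>
    ENNReal.ofReal (expNegInvGlue (1 - ∑ i, ‖z i‖ ^ 2)) := by
  have := continuous_expNegInvGlue
  exact (this.comp (by fun_prop)).measurable.ennreal_ofReal

theorem integral_weightedVolume (g : (Fin n → ℂ) → ℂ) :
    ∫ z, g z ∂weightedVolume n = ∫ z, g z * (expNegInvGlue (1 - ∑ i, ‖z i‖ ^ 2) : ℝ) := by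
  rw [weightedVolume_eq, integral_withDensity_eq_integral_toReal_smul
    measurable_ofReal_expNegInvGlue (by simp)]
  refine integral_congr_ae (Eventually.of_forall fun z => ?_)
  simp only [ENNReal.toReal_ofReal (expNegInvGlue.nonneg _), Complex.real_smul]
  ring

theorem integrable_weightedVolume_iff {g : (Fin n → ℂ) → ℂ} :
    Integrable g (weightedVolume n) ↔
      Integrable fun z => g z * (expNegInvGlue (1 - ∑ i, ‖z i‖ ^ 2) : ℝ) := by
  rw [weightedVolume_eq, integrable_withDensity_iff_integrable_smul'
    measurable_ofReal_expNegInvGlue (by simp)]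
  refine integrable_congr (Eventually.of_forall fun z => ?_)
  simp only [ENNReal.toReal_ofReal (expNegInvGlue.nonneg _), Complex.real_smul]
  ring

theorem unitBall_subset_closedBall : unitBall n ⊆ Metric.closedBall 0 1 := by
  intro z hz
  rw [mem_closedBall_zero_iff, pi_norm_le_iff_of_nonneg zero_le_one]
  intro i
  have h1 : ‖z i‖ ^ 2 ≤ ∑ i, ‖z i‖ ^ 2 :=
    Finset.single_le_sum (f := fun i => ‖z i‖ ^ 2) (fun _ _ => by positivity) (Finset.mem_univ i)
  have h2 : ∑ i, ‖z i‖ ^ 2 < 1 := hz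
  nlinarith [norm_nonneg (z i)]

theorem ae_mem_unitBall : ∀ᵐ z ∂weightedVolume n, z ∈ unitBall n :=
  (weightedVolume_absolutelyContinuous n).ae_le (ae_restrict_mem (isOpen_unitBall n).measurableSet)

instance : IsFiniteMeasure (weightedVolume n) := by
  refine ⟨?_⟩
  rw [weightedVolume_eq, withDensity_apply _ MeasurableSet.univ, Measure.restrict_univ]
  have h : Integrable fun z : Fin n → ℂ => expNegInvGlue (1 - ∑ i, ‖z i‖ ^ 2) := by
    simpa using integrable_radialNormSq (n := n) continuous_expNegInvGlue
      (fun _ => expNegInvGlue.zero_of_nonpos) 1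
  exact h.lintegral_lt_top

theorem exists_norm_le_on_unitBall {g : (Fin n → ℂ) → ℂ} (hg : Continuous g) :
    ∃ C, ∀ z ∈ unitBall n, ‖g z‖ ≤ C := by
  obtain ⟨C, hC⟩ := (isCompact_closedBall (0 : Fin n → ℂ) 1).exists_bound_of_continuousOn
    hg.continuousOn
  exact ⟨C, fun z hz => hC z (unitBall_subset_closedBall hz)⟩

theorem memLp_of_continuous {g : (Fin n → ℂ) → ℂ} (hg : Continuous g) :
    MemLp g 2 (weightedVolume n) := by
  obtain ⟨C, hC⟩ := exists_norm_le_on_unitBall hg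
  exact MemLp.of_bound hg.aestronglyMeasurable C (ae_mem_unitBall.mono hC)

/-- The class in `L²(𝔹ⁿ, μ)` of a holomorphic polynomial. -/
def polyL2 (n : ℕ) : MvPolynomial (Fin n) ℂ →ₗ[ℂ] WeightedL2 n where
  toFun q := (memLp_of_continuous (MvPolynomial.continuous_eval q)).toLp _
  map_add' q r := by
    rw [← MemLp.toLp_add]
    congr 1
    funext z
    simp
  map_smul' c q := by
    rw [RingHom.id_apply, ← MemLp.toLp_const_smul]
    congr 1
    funext z
    simp

theorem coeFn_polyL2 (q : MvPolynomial (Fin n) ℂ) :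
    polyL2 n q =ᵐ[weightedVolume n] fun z => MvPolynomial.eval z q :=
  MemLp.coeFn_toLp (memLp_of_continuous (MvPolynomial.continuous_eval q))

theorem inner_polyL2_left (q : MvPolynomial (Fin n) ℂ) (f : WeightedL2 n) :
    inner ℂ (polyL2 n q) f = ∫ z, f z * conj (MvPolynomial.eval z q) ∂weightedVolume n := by
  rw [L2.inner_def]
  refine integral_congr_ae ?_
  filter_upwards [coeFn_polyL2 q] with z hz
  rw [hz, RCLike.inner_apply]

theorem norm_polyL2_sq (q : MvPolynomial (Fin n) ℂ) :
    ‖polyL2 n q‖ ^ 2 = radialNormSq expNegInvGlue q := by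
  have h : ((‖polyL2 n q‖ ^ 2 : ℝ) : ℂ) = radialNormSq expNegInvGlue q := by
    rw [← radialPairing_self, radialPairing]
    have := inner_self_eq_norm_sq_to_K (𝕜 := ℂ) (polyL2 n q)
    push_cast
    refine this.symm.trans ?_
    rw [inner_polyL2_left]
    have : ∫ z, polyL2 n q z * conj (MvPolynomial.eval z q) ∂weightedVolume n =
        ∫ z, MvPolynomial.eval z q * conj (MvPolynomial.eval z q) ∂weightedVolume n := by
      refine integral_congr_ae ?_
      filter_upwards [coeFn_polyL2 q] with z hz
      rw [hz]
    rw [this, integral_weightedVolume]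
    simp only [mul_assoc]
  exact_mod_cast h

theorem norm_polyL2_pderiv_sq_le (hn : 1 ≤ n) : ∃ C : ℝ, 1 ≤ C ∧
    ∀ (q : MvPolynomial (Fin n) ℂ) (d : ℕ), q.IsHomogeneous d → ∀ j : Fin n,
      ‖polyL2 n (MvPolynomial.pderiv j q)‖ ^ 2 ≤ C * (1 + d) ^ 2 * ‖polyL2 n q‖ ^ 2 := by
  refine ⟨((gluePrimitive (1 / 2))⁻¹ + 2) * n, ?_, fun q d hq j => ?_⟩
  · have hn' : (1 : ℝ) ≤ n := by exact_mod_cast hn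
    have : 0 < (gluePrimitive (1 / 2))⁻¹ := inv_pos.2 (gluePrimitive_pos (by norm_num))
    nlinarith
  · rw [norm_polyL2_sq, norm_polyL2_sq]
    exact radialNormSq_pderiv_le hn hq j

end

/-! ### Weak derivatives -/

section

variable {n : ℕ} {f g : WeightedL2 n}

theorem integral_weightedVolume_eq_setIntegral (g : (Fin n → ℂ) → ℂ) :
    ∫ z, g z ∂weightedVolume n = ∫ z in unitBall n, weight z • g z := by
  rw [weightedVolume, integral_withDensity_eq_integral_toReal_smul
    (measurable_weight n).ennreal_ofReal (by simp)]
  simp only [ENNReal.toReal_ofReal (weight_pos _).le]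

/-- Integration against a continuous function with compact support in the ball is a bounded
functional on `L²(𝔹ⁿ, μ)`. -/
theorem exists_setIntegral_mul_eq_inner {ψ : (Fin n → ℂ) → ℂ} (hψ : Continuous ψ)
    (hs : tsupport ψ ⊆ unitBall n) :
    ∃ u : WeightedL2 n, ∀ f : WeightedL2 n, ∫ z in unitBall n, f z * ψ z = inner ℂ u f := by
  have hcont : Continuous fun z => conj (ψ z) * ((weight z)⁻¹ : ℝ) := by
    refine continuous_of_tsupport fun z hz => ?_
    have hz' : z ∈ unitBall n := by
      refine hs (closure_mono ?_ hz)
      intro w hw h0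
      exact hw (by simp [h0])
    have h1 : ContinuousAt (weight (n := n)) z :=
      (continuousOn_weight n).continuousAt ((isOpen_unitBall n).mem_nhds hz')
    have h2 : ContinuousAt (fun z => (weight z)⁻¹) z := h1.inv₀ (weight_pos z).ne'
    exact (Complex.continuous_conj.comp hψ).continuousAt.mul
      (Complex.continuous_ofReal.continuousAt.comp h2)
  refine ⟨(memLp_of_continuous hcont).toLp _, fun f => ?_⟩
  rw [L2.inner_def, integral_weightedVolume_eq_setIntegral]
  refine integral_congr_ae ?_
  filter_upwards [(volume_restrict_absolutelyContinuous n).ae_le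
    (memLp_of_continuous hcont).coeFn_toLp] with z hz
  rw [hz, RCLike.inner_apply, Complex.real_smul]
  have : (weight z : ℂ) ≠ 0 := Complex.ofReal_ne_zero.2 (weight_pos z).ne'
  simp
  field_simp

theorem IsWeakDeriv.of_tendsto {β γ : Fin n → ℕ} {u v : ℕ → WeightedL2 n}
    (h : ∀ m, IsWeakDeriv β γ (u m) (v m)) (hu : Tendsto u atTop (𝓝 f))
    (hv : Tendsto v atTop (𝓝 g)) : IsWeakDeriv β γ f g := by
  intro φ hφ
  have hφ' := hφ.wirtingerDeriv β γ
  obtain ⟨x, hx⟩ := exists_setIntegral_mul_eq_inner hφ'.1.continuous hφ'.2.2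
  obtain ⟨y, hy⟩ := exists_setIntegral_mul_eq_inner hφ.1.continuous hφ.2.2
  have h' : ∀ m, inner ℂ x (u m) = (-1) ^ (∑ i, (β i + γ i)) * inner ℂ y (v m) := fun m => by
    rw [← hx, ← hy]
    exact h m φ hφ
  rw [hx, hy]
  refine tendsto_nhds_unique (tendsto_const_nhds.inner hu) ?_
  simp only [h']
  exact (tendsto_const_nhds.inner hv).const_mul _

theorem isWeakDeriv_zero (f : WeightedL2 n) : IsWeakDeriv 0 0 f f := by
  intro φ _
  simp [wirtingerDeriv_zero]

theorem isWeakDeriv_single_right {j : Fin n} :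
    IsWeakDeriv 0 (Pi.single j 1) f g ↔ ∀ φ : (Fin n → ℂ) → ℂ, IsTestFunction φ →
      ∫ z in unitBall n, f z * dz j φ z = -∫ z in unitBall n, g z * φ z := by
  refine forall₂_congr fun φ hφ => ?_
  rw [← zero_add (Pi.single j 1), wirtingerDeriv_add_single_right _ _ _ hφ.1, wirtingerDeriv_zero]
  simp

theorem isWeakDeriv_single_left {j : Fin n} :
    IsWeakDeriv (Pi.single j 1) 0 f g ↔ ∀ φ : (Fin n → ℂ) → ℂ, IsTestFunction φ →
      ∫ z in unitBall n, f z * dzbar j φ z = -∫ z in unitBall n, g z * φ z := by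
  refine forall₂_congr fun φ hφ => ?_
  rw [← zero_add (Pi.single j 1), wirtingerDeriv_add_single_left _ _ _ hφ.1, wirtingerDeriv_zero]
  simp

theorem sum_add_single_right (β γ : Fin n → ℕ) (j : Fin n) :
    ∑ i, (β i + (γ + Pi.single j 1 : Fin n → ℕ) i) = ∑ i, (β i + γ i) + 1 := by
  simp [Finset.sum_add_distrib, add_assoc]

theorem sum_add_single_left (β γ : Fin n → ℕ) (j : Fin n) :
    ∑ i, ((β + Pi.single j 1 : Fin n → ℕ) i + γ i) = ∑ i, (β i + γ i) + 1 := by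
  simp [Finset.sum_add_distrib]
  ring

/-- Given `∂f/∂zⱼ`, the derivatives of `f` of type `(β, γ + eⱼ)` are those of `∂f/∂zⱼ` of
type `(β, γ)`. -/
theorem isWeakDeriv_add_single_right_iff {β γ : Fin n → ℕ} {j : Fin n} {h : WeightedL2 n}
    (hf : IsWeakDeriv 0 (Pi.single j 1) f g) :
    IsWeakDeriv β (γ + Pi.single j 1) f h ↔ IsWeakDeriv β γ g h := by
  refine forall₂_congr fun φ hφ => ?_
  rw [sum_add_single_right, wirtingerDeriv_add_single_right _ _ _ hφ.1,
    ← dz_wirtingerDeriv _ _ _ hφ.1, isWeakDeriv_single_right.1 hf _ (hφ.wirtingerDeriv β γ),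
    pow_succ, mul_neg_one, neg_mul, neg_inj]

theorem isWeakDeriv_add_single_left_iff {β γ : Fin n → ℕ} {j : Fin n} {h : WeightedL2 n}
    (hf : IsWeakDeriv (Pi.single j 1) 0 f g) :
    IsWeakDeriv (β + Pi.single j 1) γ f h ↔ IsWeakDeriv β γ g h := by
  refine forall₂_congr fun φ hφ => ?_
  rw [sum_add_single_left, wirtingerDeriv_add_single_left _ _ _ hφ.1,
    ← dzbar_wirtingerDeriv _ _ _ hφ.1, isWeakDeriv_single_left.1 hf _ (hφ.wirtingerDeriv β γ),
    pow_succ, mul_neg_one, neg_mul, neg_inj]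

theorem isWeakDeriv_zero_zero (β γ : Fin n → ℕ) : IsWeakDeriv β γ (0 : WeightedL2 n) 0 := by
  intro φ hφ
  have key : ∀ ψ : (Fin n → ℂ) → ℂ, IsTestFunction ψ →
      ∫ z in unitBall n, (0 : WeightedL2 n) z * ψ z = 0 := by
    intro ψ hψ
    obtain ⟨x, hx⟩ := exists_setIntegral_mul_eq_inner hψ.1.continuous hψ.2.2
    rw [hx, inner_zero_right]
  rw [key _ hφ, key _ (hφ.wirtingerDeriv β γ), mul_zero]

/-! ### The Sobolev norms -/

theorem weakDeriv_eq {β γ : Fin n → ℕ} (h : IsWeakDeriv β γ f g) : weakDeriv β γ f = g := by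
  have hex : ∃ g, IsWeakDeriv β γ f g := ⟨g, h⟩
  rw [weakDeriv, dif_pos hex]
  exact hex.choose_spec.unique h

theorem integral_norm_sq (g : WeightedL2 n) : ∫ z, ‖g z‖ ^ 2 ∂weightedVolume n = ‖g‖ ^ 2 := by
  have h := inner_self_eq_norm_sq_to_K (𝕜 := ℂ) g
  rw [L2.inner_def] at h
  have h2 : ∀ z, inner ℂ (g z) (g z) = ((‖g z‖ ^ 2 : ℝ) : ℂ) := fun z => by
    rw [inner_self_eq_norm_sq_to_K]
    push_cast
    rfl
  simp only [h2] at h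
  rw [integral_complex_ofReal] at h
  exact Complex.ofReal_injective (h.trans (by simp))

theorem sobolevNorm_sq (k : ℕ) (f : WeightedL2 n) :
    sobolevNorm k f ^ 2 = ∑ p ∈ multiIndices n k, ‖weakDeriv p.1 p.2 f‖ ^ 2 := by
  rw [sobolevNorm, Real.sq_sqrt
    (Finset.sum_nonneg fun _ _ => integral_nonneg fun _ => by positivity)]
  exact Finset.sum_congr rfl fun p _ => integral_norm_sq _

theorem sobolevNorm_nonneg (k : ℕ) (f : WeightedL2 n) : 0 ≤ sobolevNorm k f :=
  Real.sqrt_nonneg _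

theorem MemSobolev.mono {k l : ℕ} (h : MemSobolev l f) (hkl : k ≤ l) : MemSobolev k f :=
  fun p hp => h p (mem_multiIndices.2 ((mem_multiIndices.1 hp).trans hkl))

theorem sobolevNorm_sq_mono {k l : ℕ} (hkl : k ≤ l) (f : WeightedL2 n) :
    sobolevNorm k f ^ 2 ≤ sobolevNorm l f ^ 2 := by
  rw [sobolevNorm_sq, sobolevNorm_sq]
  exact Finset.sum_le_sum_of_subset_of_nonneg
    (fun p hp => mem_multiIndices.2 ((mem_multiIndices.1 hp).trans hkl)) fun _ _ _ => by positivity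

theorem norm_sq_le_sobolevNorm_sq (k : ℕ) (f : WeightedL2 n) : ‖f‖ ^ 2 ≤ sobolevNorm k f ^ 2 := by
  rw [sobolevNorm_sq]
  have h := Finset.single_le_sum (f := fun p : (Fin n → ℕ) × (Fin n → ℕ) =>
    ‖weakDeriv p.1 p.2 f‖ ^ 2) (s := multiIndices n k) (fun _ _ => by positivity)
    (mem_multiIndices.2 (by simp) : ((0, 0) : (Fin n → ℕ) × (Fin n → ℕ)) ∈ multiIndices n k)
  simpa only [weakDeriv_eq (isWeakDeriv_zero f)] using h

theorem MemSobolev.exists_dz {k : ℕ} (h : MemSobolev (k + 1) f) (j : Fin n) :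
    ∃ g, IsWeakDeriv 0 (Pi.single j 1) f g ∧ MemSobolev k g ∧
      sobolevNorm k g ^ 2 ≤ sobolevNorm (k + 1) f ^ 2 := by
  obtain ⟨g, hg⟩ := h (0, Pi.single j 1) (mem_multiIndices.2 (by simp))
  have hmem : ∀ p ∈ multiIndices n k, (p.1, p.2 + Pi.single j 1) ∈ multiIndices n (k + 1) := by
    intro p hp
    have := mem_multiIndices.1 hp
    exact mem_multiIndices.2 ((sum_add_single_right p.1 p.2 j).le.trans (by omega))
  have hW : MemSobolev k g := by
    intro p hp
    obtain ⟨u, hu⟩ := h _ (hmem p hp)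
    exact ⟨u, (isWeakDeriv_add_single_right_iff hg).1 hu⟩
  refine ⟨g, hg, hW, ?_⟩
  rw [sobolevNorm_sq, sobolevNorm_sq]
  have hinj : Function.Injective fun p : (Fin n → ℕ) × (Fin n → ℕ) =>
      (p.1, p.2 + Pi.single j 1) := by
    rintro ⟨p, p'⟩ ⟨q, q'⟩ hpq
    simp only [Prod.mk.injEq, add_left_inj] at hpq
    exact Prod.ext hpq.1 hpq.2
  calc ∑ p ∈ multiIndices n k, ‖weakDeriv p.1 p.2 g‖ ^ 2
      = ∑ p ∈ (multiIndices n k).map ⟨_, hinj⟩, ‖weakDeriv p.1 p.2 f‖ ^ 2 := by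
        rw [Finset.sum_map]
        refine Finset.sum_congr rfl fun p hp => ?_
        obtain ⟨u, hu⟩ := hW p hp
        rw [weakDeriv_eq hu]
        simp only [Function.Embedding.coeFn_mk]
        rw [weakDeriv_eq ((isWeakDeriv_add_single_right_iff hg).2 hu)]
    _ ≤ _ := by
        refine Finset.sum_le_sum_of_subset_of_nonneg (fun p hp => ?_) fun _ _ _ => by positivity
        obtain ⟨q, hq, rfl⟩ := Finset.mem_map.1 hp
        exact hmem q hq

theorem MemSobolev.exists_dzbar {k : ℕ} (h : MemSobolev (k + 1) f) (j : Fin n) :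
    ∃ g, IsWeakDeriv (Pi.single j 1) 0 f g ∧ MemSobolev k g ∧
      sobolevNorm k g ^ 2 ≤ sobolevNorm (k + 1) f ^ 2 := by
  obtain ⟨g, hg⟩ := h (Pi.single j 1, 0) (mem_multiIndices.2 (by simp))
  have hmem : ∀ p ∈ multiIndices n k, (p.1 + Pi.single j 1, p.2) ∈ multiIndices n (k + 1) := by
    intro p hp
    have := mem_multiIndices.1 hp
    exact mem_multiIndices.2 ((sum_add_single_left p.1 p.2 j).le.trans (by omega))
  have hW : MemSobolev k g := by
    intro p hp
    obtain ⟨u, hu⟩ := h _ (hmem p hp)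
    exact ⟨u, (isWeakDeriv_add_single_left_iff hg).1 hu⟩
  refine ⟨g, hg, hW, ?_⟩
  rw [sobolevNorm_sq, sobolevNorm_sq]
  have hinj : Function.Injective fun p : (Fin n → ℕ) × (Fin n → ℕ) =>
      (p.1 + Pi.single j 1, p.2) := by
    rintro ⟨p, p'⟩ ⟨q, q'⟩ hpq
    simp only [Prod.mk.injEq, add_left_inj] at hpq
    exact Prod.ext hpq.1 hpq.2
  calc ∑ p ∈ multiIndices n k, ‖weakDeriv p.1 p.2 g‖ ^ 2
      = ∑ p ∈ (multiIndices n k).map ⟨_, hinj⟩, ‖weakDeriv p.1 p.2 f‖ ^ 2 := by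
        rw [Finset.sum_map]
        refine Finset.sum_congr rfl fun p hp => ?_
        obtain ⟨u, hu⟩ := hW p hp
        rw [weakDeriv_eq hu]
        simp only [Function.Embedding.coeFn_mk]
        rw [weakDeriv_eq ((isWeakDeriv_add_single_left_iff hg).2 hu)]
    _ ≤ _ := by
        refine Finset.sum_le_sum_of_subset_of_nonneg (fun p hp => ?_) fun _ _ _ => by positivity
        obtain ⟨q, hq, rfl⟩ := Finset.mem_map.1 hp
        exact hmem q hq

/-! ### Weak derivatives of polynomials -/

theorem setIntegral_polyL2_mul (q : MvPolynomial (Fin n) ℂ) {φ : (Fin n → ℂ) → ℂ}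
    (hφ : IsTestFunction φ) :
    ∫ z in unitBall n, polyL2 n q z * φ z = ∫ z, MvPolynomial.eval z q * φ z := by
  rw [← setIntegral_eq_integral_of_forall_compl_eq_zero (s := unitBall n)
    (f := fun z => MvPolynomial.eval z q * φ z)]
  · refine integral_congr_ae ?_
    filter_upwards [(volume_restrict_absolutelyContinuous n).ae_le (coeFn_polyL2 q)] with z hz
    rw [hz]
  · intro z hz
    rw [image_eq_zero_of_notMem_tsupport fun h => hz (hφ.2.2 h), mul_zero]

theorem isWeakDeriv_polyL2_dz (q : MvPolynomial (Fin n) ℂ) (j : Fin n) :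
    IsWeakDeriv 0 (Pi.single j 1) (polyL2 n q) (polyL2 n (MvPolynomial.pderiv j q)) := by
  rw [isWeakDeriv_single_right]
  intro φ hφ
  have h := integral_mul_wirtingerOp (c := -Complex.I) (i := j)
    ((contDiff_eval q).of_le (by simp)) (hφ.1.of_le (by simp)) hφ.2.1
  have hd : IsTestFunction (dz j φ) := by
    rw [dz_eq_wirtingerOp]
    exact hφ.wirtingerOp
  simp only [← dz_eq_wirtingerOp, dz_eval] at h
  rw [setIntegral_polyL2_mul _ hd, setIntegral_polyL2_mul _ hφ, h]

theorem isWeakDeriv_polyL2_dzbar (q : MvPolynomial (Fin n) ℂ) (j : Fin n) :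
    IsWeakDeriv (Pi.single j 1) 0 (polyL2 n q) 0 := by
  rw [← map_zero (polyL2 n), isWeakDeriv_single_left]
  intro φ hφ
  have h := integral_mul_wirtingerOp (c := Complex.I) (i := j)
    ((contDiff_eval q).of_le (by simp)) (hφ.1.of_le (by simp)) hφ.2.1
  have hd : IsTestFunction (dzbar j φ) := by
    rw [dzbar_eq_wirtingerOp]
    exact hφ.wirtingerOp
  simp only [← dzbar_eq_wirtingerOp, dzbar_eval] at h
  rw [setIntegral_polyL2_mul _ hd, setIntegral_polyL2_mul _ hφ, h]
  simp

theorem exists_eq_add_single {γ : Fin n → ℕ} (h : γ ≠ 0) :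
    ∃ (γ' : Fin n → ℕ) (j : Fin n), γ = γ' + Pi.single j 1 := by
  obtain ⟨j, hj⟩ := Function.ne_iff.1 h
  refine ⟨γ - Pi.single j 1, j, (tsub_add_cancel_of_le ?_).symm⟩
  intro i
  by_cases hi : i = j
  · subst hi
    simpa [Nat.one_le_iff_ne_zero] using hj
  · simp [Pi.single_eq_of_ne hi]

/-- The holomorphic derivative `∂^γ` of polynomials, with its effect on degrees and norms. -/
theorem exists_polynomial_deriv (hn : 1 ≤ n) (γ : Fin n → ℕ) :
    ∃ C : ℝ, 0 ≤ C ∧ ∃ D : MvPolynomial (Fin n) ℂ →ₗ[ℂ] MvPolynomial (Fin n) ℂ,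
      (∀ q, IsWeakDeriv 0 γ (polyL2 n q) (polyL2 n (D q))) ∧
      ∀ q d, q.IsHomogeneous d → (D q).IsHomogeneous (d - ∑ i, γ i) ∧
        (d < ∑ i, γ i → D q = 0) ∧
        ‖polyL2 n (D q)‖ ^ 2 ≤ C * (1 + d : ℝ) ^ (2 * ∑ i, γ i) * ‖polyL2 n q‖ ^ 2 := by
  obtain ⟨C, hC1, hC⟩ := norm_polyL2_pderiv_sq_le hn
  have hC0 : 0 ≤ C := zero_le_one.trans hC1
  induction hm : ∑ i, γ i generalizing γ with
  | zero =>
    have hγ : γ = 0 := by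
      funext i
      exact (Finset.sum_eq_zero_iff.1 hm) i (Finset.mem_univ i)
    subst hγ
    exact ⟨1, zero_le_one, LinearMap.id, fun q => isWeakDeriv_zero _,
      fun q d hq => ⟨hq, fun h => absurd h (by simp), by simp⟩⟩
  | succ m ih =>
    obtain ⟨γ, j, rfl⟩ : ∃ (γ' : Fin n → ℕ) (j : Fin n), γ = γ' + Pi.single j 1 :=
      exists_eq_add_single (by rintro rfl; simp at hm)
    have hγ : ∑ i, γ i = m := by simpa [Finset.sum_add_distrib] using hm
    obtain ⟨A, hA, D, hD, hD'⟩ := ih γ hγ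
    refine ⟨C * A, mul_nonneg hC0 hA, D ∘ₗ (MvPolynomial.pderiv j).toLinearMap,
      fun q => (isWeakDeriv_add_single_right_iff (isWeakDeriv_polyL2_dz q j)).2 (hD _),
      fun q d hq => ?_⟩
    obtain ⟨h1, h0, h2⟩ := hD' _ _ (hq.pderiv (i := j))
    refine ⟨?_, fun hd => ?_, h2.trans ?_⟩
    · rwa [Nat.sub_sub, add_comm 1 m] at h1
    · rcases Nat.eq_zero_or_pos d with rfl | hd'
      · rw [← MvPolynomial.totalDegree_zero_iff_isHomogeneous,
          MvPolynomial.totalDegree_eq_zero_iff_eq_C] at hq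
        rw [hq]
        simp
      · exact h0 (by omega)
    · have h3 : (((d - 1 : ℕ)) : ℝ) ≤ d := by exact_mod_cast Nat.sub_le _ _
      have h4 : (1 + ((d - 1 : ℕ) : ℝ)) ^ (2 * m) ≤ (1 + d : ℝ) ^ (2 * m) :=
        pow_le_pow_left₀ (by positivity) (by linarith) _
      calc A * (1 + ((d - 1 : ℕ) : ℝ)) ^ (2 * m) * ‖polyL2 n (MvPolynomial.pderiv j q)‖ ^ 2
          ≤ A * (1 + d : ℝ) ^ (2 * m) * (C * (1 + d) ^ 2 * ‖polyL2 n q‖ ^ 2) := by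
            gcongr
            exact hC q d hq j
        _ = _ := by ring

end

/-! ### Multiplication by polynomials in `z` and `z̄` -/

section

variable {n : ℕ}

theorem continuous_eval_mul_conj_eval (a b : MvPolynomial (Fin n) ℂ) :
    Continuous fun z : Fin n → ℂ => MvPolynomial.eval z a * conj (MvPolynomial.eval z b) :=
  (MvPolynomial.continuous_eval a).mul
    (Complex.continuous_conj.comp (MvPolynomial.continuous_eval b))

theorem exists_ae_norm_mul_le (a b : MvPolynomial (Fin n) ℂ) :
    ∃ C : ℝ, ∀ f : (Fin n → ℂ) → ℂ, ∀ᵐ z ∂weightedVolume n,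
      ‖MvPolynomial.eval z a * conj (MvPolynomial.eval z b) * f z‖ ≤ C * ‖f z‖ := by
  obtain ⟨C, hC⟩ := exists_norm_le_on_unitBall (continuous_eval_mul_conj_eval a b)
  refine ⟨C, fun f => ?_⟩
  filter_upwards [ae_mem_unitBall] with z hz
  rw [norm_mul]
  exact mul_le_mul_of_nonneg_right (hC z hz) (norm_nonneg _)

theorem memLp_mulPoly (a b : MvPolynomial (Fin n) ℂ) (f : WeightedL2 n) :
    MemLp (fun z => MvPolynomial.eval z a * conj (MvPolynomial.eval z b) * f z) 2
      (weightedVolume n) := by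
  obtain ⟨C, hC⟩ := exists_ae_norm_mul_le a b
  exact MemLp.of_le_mul (Lp.memLp f)
    ((continuous_eval_mul_conj_eval a b).aestronglyMeasurable.mul (Lp.memLp f).1) (hC f)

/-- Multiplication by `a(z) b(z)‾` on `L²(𝔹ⁿ, μ)`, for polynomials `a` and `b`. -/
def mulPoly (a b : MvPolynomial (Fin n) ℂ) (f : WeightedL2 n) : WeightedL2 n :=
  (memLp_mulPoly a b f).toLp _

theorem coeFn_mulPoly (a b : MvPolynomial (Fin n) ℂ) (f : WeightedL2 n) :
    mulPoly a b f =ᵐ[weightedVolume n]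
      fun z => MvPolynomial.eval z a * conj (MvPolynomial.eval z b) * f z :=
  (memLp_mulPoly a b f).coeFn_toLp

theorem exists_norm_mulPoly_sq_le (a b : MvPolynomial (Fin n) ℂ) :
    ∃ C : ℝ, 0 ≤ C ∧ ∀ f : WeightedL2 n, ‖mulPoly a b f‖ ^ 2 ≤ C * ‖f‖ ^ 2 := by
  obtain ⟨C, hC⟩ := exists_ae_norm_mul_le a b
  refine ⟨C ^ 2, sq_nonneg C, fun f => ?_⟩
  rw [← mul_pow]
  refine pow_le_pow_left₀ (norm_nonneg _) (Lp.norm_le_mul_norm_of_ae_le_mul ?_) 2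
  filter_upwards [hC f, coeFn_mulPoly a b f] with z h1 h2
  rwa [h2]

theorem mulPoly_one_one (f : WeightedL2 n) : mulPoly 1 1 f = f := by
  refine Lp.ext ((coeFn_mulPoly 1 1 f).trans (Eventually.of_forall fun z => ?_))
  simp

/-! ### The rotational vector field -/

/-- The polynomial moment `∫ f a b̄ dμ` of `f`. -/
def moment (f : WeightedL2 n) (a b : MvPolynomial (Fin n) ℂ) : ℂ :=
  ∫ z, f z * (MvPolynomial.eval z a * conj (MvPolynomial.eval z b)) ∂weightedVolume n

theorem inner_polyL2_mulPoly (q a b : MvPolynomial (Fin n) ℂ) (f : WeightedL2 n) :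
    inner ℂ (polyL2 n q) (mulPoly a b f) = moment f a (b * q) := by
  rw [inner_polyL2_left]
  refine integral_congr_ae ?_
  filter_upwards [coeFn_mulPoly a b f] with z hz
  rw [hz]
  simp only [map_mul]
  ring

/-- The profile of a truncated weight: at `t = 1 - |z|²` it is `exp (-1 / (1 - (m + 1)⁻¹ - |z|²))`,
extended by zero. These radial weights have compact support in the ball and converge to `μ` from
below. -/
def truncatedGlue (m : ℕ) (t : ℝ) : ℝ := expNegInvGlue (t - (m + 1 : ℝ)⁻¹)

theorem contDiff_truncatedGlue (m : ℕ) : ContDiff ℝ ∞ (truncatedGlue m) :=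
  expNegInvGlue.contDiff.comp (contDiff_id.sub contDiff_const)

theorem truncatedGlue_le (m : ℕ) (t : ℝ) : truncatedGlue m t ≤ expNegInvGlue t :=
  expNegInvGlue.monotone (by
    have : (0 : ℝ) ≤ (m + 1 : ℝ)⁻¹ := by positivity
    linarith)

theorem tendsto_truncatedGlue (t : ℝ) :
    Tendsto (fun m => truncatedGlue m t) atTop (𝓝 (expNegInvGlue t)) := by
  have h : Tendsto (fun m : ℕ => t - (m + 1 : ℝ)⁻¹) atTop (𝓝 (t - 0)) := by
    refine tendsto_const_nhds.sub ?_
    simpa [one_div] using tendsto_one_div_add_atTop_nhds_zero_nat (𝕜 := ℝ)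
  rw [sub_zero] at h
  exact (continuous_expNegInvGlue.tendsto t).comp h

theorem isTestFunction_mul_radial (m : ℕ) {g : (Fin n → ℂ) → ℂ} (hg : ContDiff ℝ ∞ g) :
    IsTestFunction fun z => g z * ((truncatedGlue m (1 - ∑ i, ‖z i‖ ^ 2) : ℝ) : ℂ) := by
  have hm : (0 : ℝ) < (m + 1 : ℝ)⁻¹ := by positivity
  have h0 : ∀ t ≤ (m + 1 : ℝ)⁻¹, truncatedGlue m t = 0 := fun t ht =>
    expNegInvGlue.zero_of_nonpos (by linarith)
  refine ⟨hg.mul (contDiff_radial (m := ⊤) (contDiff_truncatedGlue m)),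
    (hasCompactSupport_radial fun t ht => h0 t (by linarith)).mul_left, ?_⟩
  have hc : IsClosed {z : Fin n → ℂ | ∑ i, ‖z i‖ ^ 2 ≤ 1 - (m + 1 : ℝ)⁻¹} :=
    isClosed_le (by fun_prop) continuous_const
  refine (closure_minimal (fun z hz => ?_) hc).trans fun z hz => ?_
  · by_contra h
    refine hz ?_
    have h' : 1 - (m + 1 : ℝ)⁻¹ < ∑ i, ‖z i‖ ^ 2 := not_le.1 h
    simp only
    rw [h0 _ (by linarith), Complex.ofReal_zero, mul_zero]
  · have h' : ∑ i, ‖z i‖ ^ 2 ≤ 1 - (m + 1 : ℝ)⁻¹ := hz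
    show ∑ i, ‖z i‖ ^ 2 < 1
    linarith

theorem tendsto_truncated_moment (f : WeightedL2 n) (a b : MvPolynomial (Fin n) ℂ) :
    Tendsto (fun m => ∫ z in unitBall n, f z * (MvPolynomial.eval z a *
      conj (MvPolynomial.eval z b) * ((truncatedGlue m (1 - ∑ i, ‖z i‖ ^ 2) : ℝ) : ℂ))) atTop
      (𝓝 (moment f a b)) := by
  have hint : Integrable (fun z => f z * (MvPolynomial.eval z a * conj (MvPolynomial.eval z b)))
      (weightedVolume n) := by
    refine ((memLp_mulPoly a b f).integrable (by norm_num)).congr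
      (Eventually.of_forall fun z => ?_)
    simp only
    ring
  have hint' := (integrable_weightedVolume_iff.1 hint).integrableOn (s := unitBall n)
  have hm : moment f a b = ∫ z in unitBall n, f z * (MvPolynomial.eval z a *
      conj (MvPolynomial.eval z b)) * (expNegInvGlue (1 - ∑ i, ‖z i‖ ^ 2) : ℝ) := by
    rw [moment, integral_weightedVolume]
    refine (setIntegral_eq_integral_of_forall_compl_eq_zero fun z hz => ?_).symm
    rw [expNegInvGlue_eq_zero_of_notMem hz, Complex.ofReal_zero, mul_zero]
  rw [hm]
  have hf : AEStronglyMeasurable f (volume.restrict (unitBall n)) :=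
    (Lp.memLp f).1.mono_ac (volume_restrict_absolutelyContinuous n)
  refine tendsto_integral_of_dominated_convergence _ (fun m => ?_) hint'.norm (fun m => ?_) ?_
  · refine hf.mul (Continuous.aestronglyMeasurable ?_)
    exact (continuous_eval_mul_conj_eval a b).mul
      (contDiff_radial (m := ⊤) (contDiff_truncatedGlue m)).continuous
  · refine Eventually.of_forall fun z => ?_
    rw [← mul_assoc, norm_mul, norm_mul (f z * _)]
    refine mul_le_mul_of_nonneg_left ?_ (norm_nonneg _)
    rw [Complex.norm_real, Complex.norm_real, Real.norm_of_nonneg (expNegInvGlue.nonneg _),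
      Real.norm_of_nonneg (by exact expNegInvGlue.nonneg _)]
    exact truncatedGlue_le _ _
  · refine Eventually.of_forall fun z => ?_
    have h := ((Complex.continuous_ofReal.tendsto _).comp
      (tendsto_truncatedGlue (1 - ∑ i, ‖z i‖ ^ 2))).const_mul
        (f z * (MvPolynomial.eval z a * conj (MvPolynomial.eval z b)))
    refine h.congr fun m => ?_
    simp only [Function.comp_apply]
    ring

theorem integrableOn_mul_of_isTestFunction (f : WeightedL2 n) {φ : (Fin n → ℂ) → ℂ}
    (hφ : IsTestFunction φ) : IntegrableOn (fun z => f z * φ z) (unitBall n) := by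
  obtain ⟨c, hc⟩ := exists_restrict_le hφ.2.1.isCompact hφ.2.2
  have : IsFiniteMeasure (volume.restrict (tsupport φ)) :=
    ⟨by simpa using hφ.2.1.isCompact.measure_lt_top⟩
  have hf : IntegrableOn f (tsupport φ) volume :=
    (((Lp.memLp f).smul_measure ENNReal.coe_ne_top).mono_measure hc).integrable (by norm_num)
  refine (hf.mul_continuousOn hφ.1.continuous.continuousOn hφ.2.1).of_forall_sdiff_eq_zero
    (isOpen_unitBall n).measurableSet fun z hz => ?_
  rw [image_eq_zero_of_notMem_tsupport hz.2, mul_zero]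

theorem contDiff_conj_eval (q : MvPolynomial (Fin n) ℂ) :
    ContDiff ℝ ∞ fun z : Fin n → ℂ => conj (MvPolynomial.eval z q) :=
  (Complex.conjCLE : ℂ →L[ℝ] ℂ).contDiff.comp (contDiff_eval q)

theorem wirtingerOp_eval_mul_radial {h : ℝ → ℝ} (hh : ContDiff ℝ ∞ h) (c : ℂ) (j : Fin n)
    (p q : MvPolynomial (Fin n) ℂ) (z : Fin n → ℂ) :
    wirtingerOp c j (fun z => MvPolynomial.eval z p * conj (MvPolynomial.eval z q) *
      ((h (1 - ∑ i, ‖z i‖ ^ 2) : ℝ) : ℂ)) z =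
      MvPolynomial.eval z p * conj (MvPolynomial.eval z q) *
        wirtingerOp c j (fun z => ((h (1 - ∑ i, ‖z i‖ ^ 2) : ℝ) : ℂ)) z +
      ((h (1 - ∑ i, ‖z i‖ ^ 2) : ℝ) : ℂ) *
        (MvPolynomial.eval z p * wirtingerOp c j (fun z => conj (MvPolynomial.eval z q)) z +
          conj (MvPolynomial.eval z q) * wirtingerOp c j (fun z => MvPolynomial.eval z p) z) := by
  rw [wirtingerOp_mul ((((contDiff_eval p).mul (contDiff_conj_eval q)).differentiable (by simp)) z)
    ((contDiff_radial (m := ⊤) hh).differentiable (by simp) z),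
    wirtingerOp_mul (differentiable_eval p z)
      ((contDiff_conj_eval q).differentiable (by simp) z)]

theorem dz_eval_mul_radial {h : ℝ → ℝ} (hh : ContDiff ℝ ∞ h) (j : Fin n)
    (p q : MvPolynomial (Fin n) ℂ) (z : Fin n → ℂ) :
    dz j (fun z => MvPolynomial.eval z p * conj (MvPolynomial.eval z q) *
      ((h (1 - ∑ i, ‖z i‖ ^ 2) : ℝ) : ℂ)) z =
      MvPolynomial.eval z p * conj (MvPolynomial.eval z q) *
        (-(deriv h (1 - ∑ i, ‖z i‖ ^ 2) : ℝ) * conj (z j)) +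
      ((h (1 - ∑ i, ‖z i‖ ^ 2) : ℝ) : ℂ) *
        (conj (MvPolynomial.eval z q) * MvPolynomial.eval z (MvPolynomial.pderiv j p)) := by
  rw [dz_eq_wirtingerOp, wirtingerOp_eval_mul_radial hh]
  simp only [← dz_eq_wirtingerOp]
  rw [dz_radial j (hh.differentiable (by simp) _).hasDerivAt, dz_conj_eval, dz_eval]
  ring

theorem dzbar_eval_mul_radial {h : ℝ → ℝ} (hh : ContDiff ℝ ∞ h) (j : Fin n)
    (p q : MvPolynomial (Fin n) ℂ) (z : Fin n → ℂ) :
    dzbar j (fun z => MvPolynomial.eval z p * conj (MvPolynomial.eval z q) *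
      ((h (1 - ∑ i, ‖z i‖ ^ 2) : ℝ) : ℂ)) z =
      MvPolynomial.eval z p * conj (MvPolynomial.eval z q) *
        (-(deriv h (1 - ∑ i, ‖z i‖ ^ 2) : ℝ) * z j) +
      ((h (1 - ∑ i, ‖z i‖ ^ 2) : ℝ) : ℂ) *
        (MvPolynomial.eval z p * conj (MvPolynomial.eval z (MvPolynomial.pderiv j q))) := by
  rw [dzbar_eq_wirtingerOp, wirtingerOp_eval_mul_radial hh]
  simp only [← dzbar_eq_wirtingerOp]
  rw [dzbar_radial j (hh.differentiable (by simp) _).hasDerivAt, dzbar_conj_eval, dzbar_eval]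
  ring

theorem sum_eval_pderiv_X_mul {a : MvPolynomial (Fin n) ℂ} {s : ℕ} (ha : a.IsHomogeneous s)
    (z : Fin n → ℂ) :
    ∑ j, MvPolynomial.eval z (MvPolynomial.pderiv j (MvPolynomial.X j * a)) =
      (n + s) * MvPolynomial.eval z a := by
  rw [← map_sum]
  simp only [Derivation.leibniz, MvPolynomial.pderiv_X_self, smul_eq_mul, mul_one,
    Finset.sum_add_distrib, ha.sum_X_mul_pderiv]
  simp
  ring

/-- The transpose of the field `T = ∑ⱼ (zⱼ ∂/∂zⱼ - z̄ⱼ ∂/∂z̄ⱼ)` applied to `a b̄` times a radial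
function: the derivatives of the radial factor cancel. -/
theorem sum_dzbar_sub_dz {h : ℝ → ℝ} (hh : ContDiff ℝ ∞ h) {a b : MvPolynomial (Fin n) ℂ}
    {s t : ℕ} (ha : a.IsHomogeneous s) (hb : b.IsHomogeneous t) (z : Fin n → ℂ) :
    ∑ j, (dzbar j (fun z => MvPolynomial.eval z a *
        conj (MvPolynomial.eval z (MvPolynomial.X j * b)) *
          ((h (1 - ∑ i, ‖z i‖ ^ 2) : ℝ) : ℂ)) z -
      dz j (fun z => MvPolynomial.eval z (MvPolynomial.X j * a) * conj (MvPolynomial.eval z b) *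
          ((h (1 - ∑ i, ‖z i‖ ^ 2) : ℝ) : ℂ)) z) =
      ((t : ℂ) - s) * (MvPolynomial.eval z a * conj (MvPolynomial.eval z b) *
        ((h (1 - ∑ i, ‖z i‖ ^ 2) : ℝ) : ℂ)) := by
  have e : ∀ j, (dzbar j (fun z => MvPolynomial.eval z a *
        conj (MvPolynomial.eval z (MvPolynomial.X j * b)) *
          ((h (1 - ∑ i, ‖z i‖ ^ 2) : ℝ) : ℂ)) z -
      dz j (fun z => MvPolynomial.eval z (MvPolynomial.X j * a) * conj (MvPolynomial.eval z b) *
          ((h (1 - ∑ i, ‖z i‖ ^ 2) : ℝ) : ℂ)) z) =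
      ((h (1 - ∑ i, ‖z i‖ ^ 2) : ℝ) : ℂ) * MvPolynomial.eval z a *
          conj (MvPolynomial.eval z (MvPolynomial.pderiv j (MvPolynomial.X j * b))) -
        ((h (1 - ∑ i, ‖z i‖ ^ 2) : ℝ) : ℂ) * conj (MvPolynomial.eval z b) *
          MvPolynomial.eval z (MvPolynomial.pderiv j (MvPolynomial.X j * a)) := by
    intro j
    rw [dz_eval_mul_radial hh, dzbar_eval_mul_radial hh]
    simp only [map_mul, MvPolynomial.eval_X]
    ring
  rw [Finset.sum_congr rfl fun j _ => e j, Finset.sum_sub_distrib, ← Finset.mul_sum,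
    ← Finset.mul_sum, ← map_sum, sum_eval_pderiv_X_mul ha, sum_eval_pderiv_X_mul hb]
  simp only [map_mul, map_add, map_natCast]
  ring

/-- The field `T = ∑ⱼ (zⱼ ∂/∂zⱼ - z̄ⱼ ∂/∂z̄ⱼ)` generates the rotations `z ↦ e^{iθ} z`. It
annihilates the radial weight, it is formally antisymmetric, and `a b̄` is an eigenfunction of it.
The same holds with the weight cut off radially, so that no boundary or cutoff terms appear. -/
theorem moment_rotation {f : WeightedL2 n} {F G : Fin n → WeightedL2 n}
    (hF : ∀ j, IsWeakDeriv 0 (Pi.single j 1) f (F j))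
    (hG : ∀ j, IsWeakDeriv (Pi.single j 1) 0 f (G j)) {a b : MvPolynomial (Fin n) ℂ} {s t : ℕ}
    (ha : a.IsHomogeneous s) (hb : b.IsHomogeneous t) :
    ((t : ℂ) - s) * moment f a b =
      ∑ j, (moment (F j) (MvPolynomial.X j * a) b - moment (G j) a (MvPolynomial.X j * b)) := by
  refine tendsto_nhds_unique ((tendsto_truncated_moment f a b).const_mul _) ?_
  refine (tendsto_finsetSum Finset.univ fun j _ =>
    (tendsto_truncated_moment (F j) (MvPolynomial.X j * a) b).sub
      (tendsto_truncated_moment (G j) a (MvPolynomial.X j * b))).congr fun m => ?_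
  have htest : ∀ p q : MvPolynomial (Fin n) ℂ, IsTestFunction fun z =>
      MvPolynomial.eval z p * conj (MvPolynomial.eval z q) *
        ((truncatedGlue m (1 - ∑ i, ‖z i‖ ^ 2) : ℝ) : ℂ) := fun p q =>
    isTestFunction_mul_radial m ((contDiff_eval p).mul (contDiff_conj_eval q))
  have i1 : ∀ (j : Fin n) (p q : MvPolynomial (Fin n) ℂ), IntegrableOn (fun z => f z *
      dz j (fun z => MvPolynomial.eval z p * conj (MvPolynomial.eval z q) *
        ((truncatedGlue m (1 - ∑ i, ‖z i‖ ^ 2) : ℝ) : ℂ)) z) (unitBall n) := fun j p q => by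
    rw [dz_eq_wirtingerOp]
    exact integrableOn_mul_of_isTestFunction f (htest p q).wirtingerOp
  have i2 : ∀ (j : Fin n) (p q : MvPolynomial (Fin n) ℂ), IntegrableOn (fun z => f z *
      dzbar j (fun z => MvPolynomial.eval z p * conj (MvPolynomial.eval z q) *
        ((truncatedGlue m (1 - ∑ i, ‖z i‖ ^ 2) : ℝ) : ℂ)) z) (unitBall n) := fun j p q => by
    rw [dzbar_eq_wirtingerOp]
    exact integrableOn_mul_of_isTestFunction f (htest p q).wirtingerOp
  have e1 := fun j => isWeakDeriv_single_right.1 (hF j) _ (htest (MvPolynomial.X j * a) b)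
  have e2 := fun j => isWeakDeriv_single_left.1 (hG j) _ (htest a (MvPolynomial.X j * b))
  have h1 : ∀ j, (∫ z in unitBall n, F j z * (MvPolynomial.eval z (MvPolynomial.X j * a) *
        conj (MvPolynomial.eval z b) * ((truncatedGlue m (1 - ∑ i, ‖z i‖ ^ 2) : ℝ) : ℂ))) -
      ∫ z in unitBall n, G j z * (MvPolynomial.eval z a *
        conj (MvPolynomial.eval z (MvPolynomial.X j * b)) *
          ((truncatedGlue m (1 - ∑ i, ‖z i‖ ^ 2) : ℝ) : ℂ)) =
      ∫ z in unitBall n, (f z * dzbar j (fun z => MvPolynomial.eval z a *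
          conj (MvPolynomial.eval z (MvPolynomial.X j * b)) *
            ((truncatedGlue m (1 - ∑ i, ‖z i‖ ^ 2) : ℝ) : ℂ)) z -
        f z * dz j (fun z => MvPolynomial.eval z (MvPolynomial.X j * a) *
          conj (MvPolynomial.eval z b) *
            ((truncatedGlue m (1 - ∑ i, ‖z i‖ ^ 2) : ℝ) : ℂ)) z) := by
    intro j
    rw [integral_sub (i2 j _ _) (i1 j _ _), e1, e2]
    ring
  rw [Finset.sum_congr rfl fun j _ => h1 j]
  refine (integral_finsetSum Finset.univ fun j _ =>
    (i2 j _ _).sub (i1 j _ _)).symm.trans ?_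
  rw [← integral_const_mul]
  refine integral_congr_ae (Eventually.of_forall fun z => ?_)
  simp only [Pi.sub_apply, ← mul_sub]
  rw [← Finset.mul_sum, sum_dzbar_sub_dz (contDiff_truncatedGlue m) ha hb]
  ring

end

/-! ### Homogeneous components -/

section

variable {n : ℕ}

/-- The classes in `L²(𝔹ⁿ, μ)` of the homogeneous polynomials of degree `d`. -/
def homogeneousSpace (n d : ℕ) : Submodule ℂ (WeightedL2 n) :=
  (MvPolynomial.homogeneousSubmodule (Fin n) ℂ d).map (polyL2 n)

instance (n d : ℕ) : FiniteDimensional ℂ (homogeneousSpace n d) :=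
  Module.Finite.iff_fg.2 ((MvPolynomial.homogeneousSubmodule_fg (Fin n) ℂ d).map _)

/-- The degree `d` component of `f`: its orthogonal projection to the homogeneous polynomials of
degree `d`. -/
def homogeneousPart (d : ℕ) (f : WeightedL2 n) : WeightedL2 n :=
  (homogeneousSpace n d).starProjection f

theorem homogeneousPart_mem (d : ℕ) (f : WeightedL2 n) :
    homogeneousPart d f ∈ homogeneousSpace n d :=
  Submodule.starProjection_apply_mem _ _

theorem exists_polyL2_eq_homogeneousPart (d : ℕ) (f : WeightedL2 n) :
    ∃ q : MvPolynomial (Fin n) ℂ, q.IsHomogeneous d ∧ polyL2 n q = homogeneousPart d f :=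
  homogeneousPart_mem d f

theorem moment_polyL2 (q a b : MvPolynomial (Fin n) ℂ) :
    moment (polyL2 n q) a b = inner ℂ (polyL2 n b) (polyL2 n (a * q)) := by
  rw [inner_polyL2_left]
  refine integral_congr_ae ?_
  filter_upwards [coeFn_polyL2 q, coeFn_polyL2 (a * q)] with z h1 h2
  rw [h1, h2, map_mul]
  ring

theorem moment_zero (a b : MvPolynomial (Fin n) ℂ) : moment (0 : WeightedL2 n) a b = 0 := by
  rw [← map_zero (polyL2 n), moment_polyL2]
  simp

theorem inner_polyL2_of_isHomogeneous {q r : MvPolynomial (Fin n) ℂ} {d e : ℕ}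
    (hq : q.IsHomogeneous d) (hr : r.IsHomogeneous e) (hde : d ≠ e) :
    inner ℂ (polyL2 n r) (polyL2 n q) = 0 := by
  have h := moment_rotation (isWeakDeriv_polyL2_dz q) (isWeakDeriv_polyL2_dzbar q)
    (MvPolynomial.isHomogeneous_one (Fin n) ℂ) hr
  simp only [moment_polyL2, moment_zero, sub_zero, mul_one, one_mul, Nat.cast_zero] at h
  rw [← inner_sum, ← map_sum, hq.sum_X_mul_pderiv, map_nsmul, ← Nat.cast_smul_eq_nsmul ℂ,
    inner_smul_right, ← sub_eq_zero, ← sub_mul] at h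
  exact (mul_eq_zero.1 h).resolve_left (sub_ne_zero.2 (by exact_mod_cast hde.symm))

theorem orthogonalFamily_homogeneousSpace (n : ℕ) :
    OrthogonalFamily ℂ (fun d => homogeneousSpace n d)
      fun d => (homogeneousSpace n d).subtypeₗᵢ := by
  rintro d e hde ⟨_, q, hq, rfl⟩ ⟨_, r, hr, rfl⟩
  exact inner_polyL2_of_isHomogeneous hr hq hde.symm

theorem norm_sum_homogeneousPart_sq (u : WeightedL2 n) (s : Finset ℕ) :
    ‖∑ d ∈ s, homogeneousPart d u‖ ^ 2 = ∑ d ∈ s, ‖homogeneousPart d u‖ ^ 2 :=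
  (orthogonalFamily_homogeneousSpace n).norm_sum
    (fun d => ⟨homogeneousPart d u, homogeneousPart_mem d u⟩) s

/-- Bessel's inequality. -/
theorem sum_norm_homogeneousPart_sq_le (u : WeightedL2 n) (s : Finset ℕ) :
    ∑ d ∈ s, ‖homogeneousPart d u‖ ^ 2 ≤ ‖u‖ ^ 2 := by
  have h1 := norm_sum_homogeneousPart_sq u s
  have h2 : RCLike.re (inner ℂ (∑ d ∈ s, homogeneousPart d u) u) =
      ∑ d ∈ s, ‖homogeneousPart d u‖ ^ 2 := by
    rw [sum_inner, map_sum]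
    refine Finset.sum_congr rfl fun d _ => ?_
    rw [homogeneousPart, Submodule.re_inner_starProjection_eq_normSq]
    rfl
  have h3 := re_inner_le_norm (𝕜 := ℂ) (∑ d ∈ s, homogeneousPart d u) u
  rw [h2, ← h1] at h3
  rw [← h1]
  have h4 := norm_nonneg (∑ d ∈ s, homogeneousPart d u)
  have h5 := norm_nonneg u
  by_contra! hc
  have h6 : ‖u‖ < ‖∑ d ∈ s, homogeneousPart d u‖ := lt_of_pow_lt_pow_left₀ 2 h4 hc
  nlinarith

theorem homogeneousPart_eq_zero {d : ℕ} {u : WeightedL2 n}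
    (h : ∀ q : MvPolynomial (Fin n) ℂ, q.IsHomogeneous d → inner ℂ (polyL2 n q) u = 0) :
    homogeneousPart d u = 0 := by
  rw [homogeneousPart, Submodule.starProjection_apply_eq_zero_iff]
  rintro _ ⟨q, hq, rfl⟩
  exact h q hq

/-- The rotational field multiplies the degree `d` component by `d`, up to the degrees of `a` and
`b`. -/
theorem smul_homogeneousPart_mulPoly {f : WeightedL2 n} {F G : Fin n → WeightedL2 n}
    (hF : ∀ j, IsWeakDeriv 0 (Pi.single j 1) f (F j))
    (hG : ∀ j, IsWeakDeriv (Pi.single j 1) 0 f (G j)) {a b : MvPolynomial (Fin n) ℂ} {s t : ℕ}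
    (ha : a.IsHomogeneous s) (hb : b.IsHomogeneous t) (d : ℕ) :
    ((t + d : ℂ) - s) • homogeneousPart d (mulPoly a b f) =
      ∑ j, (homogeneousPart d (mulPoly (MvPolynomial.X j * a) b (F j)) -
        homogeneousPart d (mulPoly a (MvPolynomial.X j * b) (G j))) := by
  have h : homogeneousPart d (((t + d : ℂ) - s) • mulPoly a b f -
      ∑ j, (mulPoly (MvPolynomial.X j * a) b (F j) - mulPoly a (MvPolynomial.X j * b) (G j))) =
      0 := by
    refine homogeneousPart_eq_zero fun q hq => ?_
    have h1 := moment_rotation hF hG ha (hb.mul hq)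
    rw [inner_sub_right, inner_smul_right, inner_sum, inner_polyL2_mulPoly, sub_eq_zero]
    push_cast at h1
    rw [h1]
    refine Finset.sum_congr rfl fun j _ => ?_
    rw [inner_sub_right, inner_polyL2_mulPoly, inner_polyL2_mulPoly, mul_assoc]
  simp only [homogeneousPart, map_sub, map_smul, map_sum] at h ⊢
  exact sub_eq_zero.1 h

theorem one_add_mul_norm_homogeneousPart_le {f : WeightedL2 n} {F G : Fin n → WeightedL2 n}
    (hF : ∀ j, IsWeakDeriv 0 (Pi.single j 1) f (F j))
    (hG : ∀ j, IsWeakDeriv (Pi.single j 1) 0 f (G j)) {a b : MvPolynomial (Fin n) ℂ} {s t : ℕ}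
    (ha : a.IsHomogeneous s) (hb : b.IsHomogeneous t) (d : ℕ) :
    (1 + d : ℝ) * ‖homogeneousPart d (mulPoly a b f)‖ ≤
      (1 + s + t) * ‖homogeneousPart d (mulPoly a b f)‖ +
      ∑ j, (‖homogeneousPart d (mulPoly (MvPolynomial.X j * a) b (F j))‖ +
        ‖homogeneousPart d (mulPoly a (MvPolynomial.X j * b) (G j))‖) := by
  set u := homogeneousPart d (mulPoly a b f) with hu
  have h1 : ‖(1 + d : ℂ)‖ = (1 + d : ℝ) := by
    rw [show (1 + d : ℂ) = ((1 + d : ℝ) : ℂ) by push_cast; ring, Complex.norm_real,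
      Real.norm_of_nonneg (by positivity)]
  have h2 : ‖(1 + s - t : ℂ)‖ ≤ (1 + s + t : ℝ) := by
    refine (norm_sub_le _ _).trans (add_le_add ((norm_add_le _ _).trans ?_) ?_) <;> simp
  have h3 : (1 + d : ℂ) • u = ((t + d : ℂ) - s) • u + (1 + s - t : ℂ) • u := by
    rw [← add_smul]
    congr 1
    ring
  rw [← h1, ← norm_smul, h3, smul_homogeneousPart_mulPoly hF hG ha hb, add_comm]
  refine (norm_add_le _ _).trans (add_le_add ?_ ?_)
  · rw [norm_smul]
    exact mul_le_mul_of_nonneg_right h2 (norm_nonneg _)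
  · exact (norm_sum_le _ _).trans (Finset.sum_le_sum fun j _ => norm_sub_le _ _)

/-- The components of `f ∈ W^k` decay in the degree: each order of weak differentiability gains
one factor `1 + d`. -/
theorem exists_sum_homogeneousPart_le (k : ℕ) {a b : MvPolynomial (Fin n) ℂ} {s t : ℕ}
    (ha : a.IsHomogeneous s) (hb : b.IsHomogeneous t) :
    ∃ C : ℝ, 0 ≤ C ∧ ∀ f : WeightedL2 n, MemSobolev k f → ∀ N : ℕ,
      ∑ d ∈ Finset.range N, (1 + d : ℝ) ^ (2 * k) * ‖homogeneousPart d (mulPoly a b f)‖ ^ 2 ≤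
        C * sobolevNorm k f ^ 2 := by
  induction k generalizing a b s t with
  | zero =>
    obtain ⟨C, hC, h⟩ := exists_norm_mulPoly_sq_le a b
    refine ⟨C, hC, fun f _ N => ?_⟩
    simp only [mul_zero, pow_zero, one_mul]
    exact (sum_norm_homogeneousPart_sq_le _ _).trans ((h f).trans
      (mul_le_mul_of_nonneg_left (norm_sq_le_sobolevNorm_sq 0 f) hC))
  | succ k ih =>
    obtain ⟨C, hC, h⟩ := ih ha hb
    choose A hA hA' using fun j => ih ((MvPolynomial.isHomogeneous_X ℂ j).mul ha) hb
    choose B hB hB' using fun j => ih ha ((MvPolynomial.isHomogeneous_X ℂ j).mul hb)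
    refine ⟨2 * ((1 + s + t) ^ 2 * C + n * ∑ j, 2 * (A j + B j)), ?_, fun f hf N => ?_⟩
    · have : 0 ≤ ∑ j, 2 * (A j + B j) :=
        Finset.sum_nonneg fun j _ => mul_nonneg zero_le_two (add_nonneg (hA j) (hB j))
      positivity
    choose F hF hFm hFn using hf.exists_dz
    choose G hG hGm hGn using hf.exists_dzbar
    have hfk := hf.mono k.le_succ
    set S := sobolevNorm (k + 1) f ^ 2 with hS
    have hpt : ∀ d : ℕ, (1 + d : ℝ) ^ (2 * (k + 1)) * ‖homogeneousPart d (mulPoly a b f)‖ ^ 2 ≤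
        2 * ((1 + s + t) ^ 2 * ((1 + d : ℝ) ^ (2 * k) * ‖homogeneousPart d (mulPoly a b f)‖ ^ 2) +
          n * ∑ j, 2 * ((1 + d : ℝ) ^ (2 * k) *
              ‖homogeneousPart d (mulPoly (MvPolynomial.X j * a) b (F j))‖ ^ 2 +
            (1 + d : ℝ) ^ (2 * k) *
              ‖homogeneousPart d (mulPoly a (MvPolynomial.X j * b) (G j))‖ ^ 2)) := by
      intro d
      have h1 := one_add_mul_norm_homogeneousPart_le hF hG ha hb d
      set x := ‖homogeneousPart d (mulPoly a b f)‖
      set y := fun j => ‖homogeneousPart d (mulPoly (MvPolynomial.X j * a) b (F j))‖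
      set y' := fun j => ‖homogeneousPart d (mulPoly a (MvPolynomial.X j * b) (G j))‖
      have hx : 0 ≤ x := norm_nonneg _
      have h2 : ((1 + d : ℝ) * x) ^ 2 ≤ ((1 + s + t) * x + ∑ j, (y j + y' j)) ^ 2 :=
        pow_le_pow_left₀ (by positivity) h1 2
      have h3 : (∑ j, (y j + y' j)) ^ 2 ≤ n * ∑ j, 2 * (y j ^ 2 + y' j ^ 2) := by
        refine (sq_sum_le_card_mul_sum_sq (s := Finset.univ) (f := fun j => y j + y' j)).trans ?_
        rw [Finset.card_univ, Fintype.card_fin]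
        refine mul_le_mul_of_nonneg_left (Finset.sum_le_sum fun j _ => ?_) (Nat.cast_nonneg n)
        nlinarith [sq_nonneg (y j - y' j)]
      have h4 : ((1 + d : ℝ) * x) ^ 2 ≤
          2 * ((1 + s + t) ^ 2 * x ^ 2 + n * ∑ j, 2 * (y j ^ 2 + y' j ^ 2)) := by
        nlinarith [sq_nonneg ((1 + s + t) * x - ∑ j, (y j + y' j))]
      calc (1 + d : ℝ) ^ (2 * (k + 1)) * x ^ 2
          = (1 + d : ℝ) ^ (2 * k) * ((1 + d : ℝ) * x) ^ 2 := by ring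
        _ ≤ (1 + d : ℝ) ^ (2 * k) *
            (2 * ((1 + s + t) ^ 2 * x ^ 2 + n * ∑ j, 2 * (y j ^ 2 + y' j ^ 2))) :=
          mul_le_mul_of_nonneg_left h4 (by positivity)
        _ = 2 * ((1 + s + t) ^ 2 * ((1 + d : ℝ) ^ (2 * k) * x ^ 2) +
            n * ((1 + d : ℝ) ^ (2 * k) * ∑ j, 2 * (y j ^ 2 + y' j ^ 2))) := by ring
        _ = _ := by
          rw [Finset.mul_sum]
          congr 3
          refine Finset.sum_congr rfl fun j _ => ?_
          ring
    refine (Finset.sum_le_sum fun d _ => hpt d).trans ?_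
    rw [← Finset.mul_sum, Finset.sum_add_distrib, ← Finset.mul_sum, ← Finset.mul_sum,
      Finset.sum_comm]
    simp only [← Finset.mul_sum, Finset.sum_add_distrib]
    rw [mul_assoc]
    refine mul_le_mul_of_nonneg_left ?_ zero_le_two
    rw [add_mul, mul_assoc, mul_assoc, mul_assoc, add_mul, Finset.sum_mul, Finset.sum_mul]
    have hC' : ∑ d ∈ Finset.range N, (1 + d : ℝ) ^ (2 * k) *
        ‖homogeneousPart d (mulPoly a b f)‖ ^ 2 ≤ C * S :=
      (h f hfk N).trans (mul_le_mul_of_nonneg_left (sobolevNorm_sq_mono k.le_succ f) hC)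
    gcongr with j _ j _
    · exact (hA' j _ (hFm j) N).trans (mul_le_mul_of_nonneg_left (hFn j) (hA j))
    · exact (hB' j _ (hGm j) N).trans (mul_le_mul_of_nonneg_left (hGn j) (hB j))

end

/-! ### Holomorphic functions in several variables -/

section

variable {n : ℕ}

/-- The directional derivatives of a holomorphic function are holomorphic: differentiate Cauchy's
formula for the derivative along a complex line. -/
theorem differentiableOn_fderiv_apply {F : (Fin n → ℂ) → ℂ} {U : Set (Fin n → ℂ)} (hU : IsOpen U)
    (hF : DifferentiableOn ℂ F U) (v : Fin n → ℂ) :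
    DifferentiableOn ℂ (fun z => fderiv ℂ F z v) U := by
  intro z₀ hz₀
  obtain ⟨ε, hε, hεU⟩ := Metric.nhds_basis_closedBall.mem_iff.1 (hU.mem_nhds hz₀)
  obtain ⟨R, hR, rfl⟩ : ∃ R, 0 < R ∧ ε = 3 * R := ⟨ε / 3, by positivity, by ring⟩
  have hd : ∀ z ∈ Metric.closedBall z₀ (3 * R), DifferentiableAt ℂ F z := fun z hz =>
    (hF z (hεU hz)).differentiableAt (hU.mem_nhds (hεU hz))
  have hcont : ContinuousOn F (Metric.closedBall z₀ (3 * R)) := fun z hz =>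
    (hd z hz).continuousAt.continuousWithinAt
  obtain ⟨M, hM⟩ := (isCompact_closedBall z₀ (3 * R)).exists_bound_of_continuousOn hcont
  have hbound : ∀ z ∈ Metric.closedBall z₀ (2 * R), ‖fderiv ℂ F z‖ ≤ 2 * M / R := by
    intro z hz
    have hs : Metric.ball z R ⊆ Metric.closedBall z₀ (3 * R) :=
      Metric.ball_subset_closedBall.trans (Metric.closedBall_subset_closedBall' (by
        have : dist z z₀ ≤ 2 * R := hz
        linarith))
    refine Complex.norm_fderiv_le_div_of_mapsTo_ball (hF.mono (hs.trans hεU)) (fun w hw => ?_) hR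
    rw [Metric.mem_closedBall, dist_eq_norm]
    have h1 := hM w (hs hw)
    have h2 := hM z (hs (Metric.mem_ball_self hR))
    linarith [norm_sub_le (F w) (F z)]
  obtain ⟨r, hr, hrR⟩ : ∃ r : ℝ, 0 < r ∧ r * ‖v‖ ≤ R := by
    refine ⟨R / (‖v‖ + 1), by positivity, ?_⟩
    rw [div_mul_eq_mul_div, div_le_iff₀ (by positivity)]
    nlinarith [norm_nonneg v]
  have hmem : ∀ z ∈ Metric.ball z₀ R, ∀ t : ℂ, ‖t‖ ≤ r →
      z + t • v ∈ Metric.closedBall z₀ (2 * R) := by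
    intro z hz t ht
    have h1 : dist z z₀ < R := hz
    rw [Metric.mem_closedBall]
    calc dist (z + t • v) z₀ ≤ dist (z + t • v) z + dist z z₀ := dist_triangle _ _ _
      _ = ‖t‖ * ‖v‖ + dist z z₀ := by rw [dist_self_add_left, norm_smul]
      _ ≤ r * ‖v‖ + R := by gcongr
      _ ≤ 2 * R := by linarith
  have h32 : Metric.closedBall z₀ (2 * R) ⊆ Metric.closedBall z₀ (3 * R) :=
    Metric.closedBall_subset_closedBall (by linarith)
  -- Cauchy's formula on the disc of radius `r` in direction `v`
  have hcauchy : ∀ z ∈ Metric.ball z₀ R, fderiv ℂ F z v = (2 * Real.pi * Complex.I)⁻¹ *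
      ∫ θ in (0 : ℝ)..2 * Real.pi, deriv (circleMap 0 r) θ * ((circleMap 0 r θ ^ 2)⁻¹ *
        F (z + circleMap 0 r θ • v)) := by
    intro z hz
    have hline : ∀ t : ℂ, ‖t‖ ≤ r → HasDerivAt (fun t : ℂ => F (z + t • v))
        (fderiv ℂ F (z + t • v) v) t := by
      intro t ht
      have h1 : HasDerivAt (fun t : ℂ => z + t • v) v t := by
        simpa using ((hasDerivAt_id t).smul_const v).const_add z
      exact (hd _ (h32 (hmem z hz t ht))).hasFDerivAt.comp_hasDerivAt t h1
    have h1 := DifferentiableOn.circleIntegral_one_div_sub_center_pow_smul (c := 0)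
      (f := fun t : ℂ => F (z + t • v)) hr 1 (fun t ht =>
        (hline t (by simpa using ht)).differentiableAt.differentiableWithinAt)
    rw [iteratedDeriv_one, (hline 0 (by simpa using hr.le)).deriv, circleIntegral] at h1
    simp only [sub_zero, one_div, smul_eq_mul, zero_smul, add_zero, Nat.factorial_one,
      Nat.cast_one, div_one, one_add_one_eq_two] at h1
    rw [h1, ← mul_assoc, inv_mul_cancel₀ (by simp [Real.pi_ne_zero]), one_mul]
  have hcirc : Continuous (circleMap 0 r) := continuous_circleMap 0 r
  have hK : Continuous fun θ : ℝ => deriv (circleMap 0 r) θ * (circleMap 0 r θ ^ 2)⁻¹ := by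
    have hne : ∀ θ : ℝ, circleMap 0 r θ ^ 2 ≠ 0 := fun θ =>
      pow_ne_zero _ (circleMap_ne_center hr.ne')
    simp only [deriv_circleMap]
    exact (hcirc.mul continuous_const).mul ((hcirc.pow 2).inv₀ hne)
  have hKn : ∀ θ : ℝ, ‖deriv (circleMap 0 r) θ * (circleMap 0 r θ ^ 2)⁻¹‖ = r⁻¹ := fun θ => by
    simp [abs_of_pos hr]
    field_simp
  have hsm : ∀ z ∈ Metric.ball z₀ R, Continuous fun θ : ℝ => F (z + circleMap 0 r θ • v) := by
    intro z hz
    refine continuous_iff_continuousAt.2 fun θ => ?_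
    have h1 : ContinuousAt (fun θ : ℝ => z + circleMap 0 r θ • v) θ := by fun_prop
    exact ContinuousAt.comp (f := fun θ : ℝ => z + circleMap 0 r θ • v)
      (hd _ (h32 (hmem z hz _ (by simp [abs_of_pos hr])))).continuousAt h1
  have hint := intervalIntegral.hasFDerivAt_integral_of_dominated_of_fderiv_le (𝕜 := ℂ)
    (μ := volume) (a := 0) (b := 2 * Real.pi) (s := Metric.ball z₀ R) (x₀ := z₀)
    (F := fun z θ => deriv (circleMap 0 r) θ * (circleMap 0 r θ ^ 2)⁻¹ *
      F (z + circleMap 0 r θ • v))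
    (F' := fun z θ => (deriv (circleMap 0 r) θ * (circleMap 0 r θ ^ 2)⁻¹) •
      fderiv ℂ F (z + circleMap 0 r θ • v)) (bound := fun _ => r⁻¹ * (2 * M / R))
    (Metric.ball_mem_nhds z₀ hR)
    (by
      filter_upwards [Metric.ball_mem_nhds z₀ hR] with z hz
      exact (hK.mul (hsm z hz)).aestronglyMeasurable)
    ((hK.mul (hsm z₀ (Metric.mem_ball_self hR))).intervalIntegrable _ _)
    (by
      refine hK.aestronglyMeasurable.smul ?_
      refine ((measurable_fderiv ℂ F).comp ?_).aestronglyMeasurable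
      exact Continuous.measurable (by fun_prop))
    (Eventually.of_forall fun θ _ z hz => by
      rw [norm_smul, hKn]
      exact mul_le_mul_of_nonneg_left (hbound _ (hmem z hz _ (by simp [abs_of_pos hr])))
        (by positivity))
    intervalIntegrable_const
    (Eventually.of_forall fun θ _ z hz => by
      have h1 : HasFDerivAt (fun z => z + circleMap 0 r θ • v)
          (ContinuousLinearMap.id ℂ (Fin n → ℂ)) z := (hasFDerivAt_id z).add_const _
      have h2 := (hd _ (h32 (hmem z hz _ (by simp [abs_of_pos hr] :
        ‖circleMap 0 r θ‖ ≤ r)))).hasFDerivAt.comp z h1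
      exact h2.const_smul (deriv (circleMap 0 r) θ * (circleMap 0 r θ ^ 2)⁻¹))
  refine DifferentiableAt.differentiableWithinAt ?_
  have h3 := (hint.const_mul ((2 * Real.pi * Complex.I)⁻¹)).differentiableAt
  refine h3.congr_of_eventuallyEq ?_
  filter_upwards [Metric.ball_mem_nhds z₀ hR] with z hz
  rw [hcauchy z hz]
  simp only [mul_assoc]

theorem smul_mem_unitBall {z : Fin n → ℂ} (hz : z ∈ unitBall n) :
    ∃ r : ℝ, 1 < r ∧ ∀ t : ℂ, ‖t‖ < r → t • z ∈ unitBall n := by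
  set ρ := ∑ i, ‖z i‖ ^ 2 with hρ
  have h1 : ρ < 1 := hz
  have h0 : 0 ≤ ρ := Finset.sum_nonneg fun _ _ => by positivity
  refine ⟨1 + (1 - ρ) / 4, by linarith, fun t ht => ?_⟩
  have h2 : ∑ i, ‖(t • z) i‖ ^ 2 = ‖t‖ ^ 2 * ρ := by
    simp only [Pi.smul_apply, smul_eq_mul, norm_mul, mul_pow, hρ, Finset.mul_sum]
  show ∑ i, ‖(t • z) i‖ ^ 2 < 1
  rw [h2]
  have h3 : ‖t‖ ^ 2 ≤ (1 + (1 - ρ) / 4) ^ 2 := pow_le_pow_left₀ (norm_nonneg _) ht.le 2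
  have h4 : ‖t‖ ^ 2 * ρ ≤ (1 + (1 - ρ) / 4) ^ 2 * ρ := mul_le_mul_of_nonneg_right h3 h0
  have h5 := mul_nonneg h0 (sub_nonneg.2 h1.le)
  nlinarith [mul_nonneg h5 (sub_nonneg.2 h1.le)]

theorem differentiableOn_slice {F : (Fin n → ℂ) → ℂ} (hF : DifferentiableOn ℂ F (unitBall n))
    {z : Fin n → ℂ} {r : ℝ} (hr : ∀ t : ℂ, ‖t‖ < r → t • z ∈ unitBall n) :
    DifferentiableOn ℂ (fun t : ℂ => F (t • z)) (Metric.ball 0 r) := by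
  have h1 : DifferentiableOn ℂ (fun t : ℂ => t • z) (Metric.ball 0 r) := by fun_prop
  exact hF.comp h1 fun t ht => hr t (by simpa using ht)

theorem contDiffAt_slice {F : (Fin n → ℂ) → ℂ} (hF : DifferentiableOn ℂ F (unitBall n))
    {z : Fin n → ℂ} (hz : z ∈ unitBall n) (m : WithTop ℕ∞) :
    ContDiffAt ℂ m (fun t : ℂ => F (t • z)) 0 := by
  obtain ⟨r, hr, h⟩ := smul_mem_unitBall hz
  exact ((differentiableOn_slice hF h).analyticAt
    (Metric.ball_mem_nhds 0 (by linarith))).contDiffAt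

/-- The Taylor coefficients at `0` of a holomorphic function along complex lines through the
origin are homogeneous polynomials in the direction, because
`d! a_d[F](z) = ∑ⱼ zⱼ (d - 1)! a_{d-1}[∂ⱼF](z)`. -/
theorem exists_isHomogeneous_taylor (d : ℕ) {F : (Fin n → ℂ) → ℂ}
    (hF : DifferentiableOn ℂ F (unitBall n)) :
    ∃ q : MvPolynomial (Fin n) ℂ, q.IsHomogeneous d ∧ ∀ z ∈ unitBall n,
      iteratedDeriv d (fun t : ℂ => F (t • z)) 0 = MvPolynomial.eval z q := by
  induction d generalizing F with
  | zero => exact ⟨MvPolynomial.C (F 0), MvPolynomial.isHomogeneous_C _ _, fun z _ => by simp⟩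
  | succ d ih =>
    have hF' : ∀ j, DifferentiableOn ℂ (fun z => fderiv ℂ F z (Pi.single j 1)) (unitBall n) :=
      fun j => differentiableOn_fderiv_apply (isOpen_unitBall n) hF _
    choose q hq hq' using fun j => ih (hF' j)
    refine ⟨∑ j, MvPolynomial.X j * q j, MvPolynomial.IsHomogeneous.sum _ _ _ fun j _ => ?_,
      fun z hz => ?_⟩
    · rw [add_comm]
      exact (MvPolynomial.isHomogeneous_X ℂ j).mul (hq j)
    · have hderiv : deriv (fun t : ℂ => F (t • z)) =ᶠ[𝓝 0]
          fun t => ∑ j, z j * fderiv ℂ F (t • z) (Pi.single j 1) := by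
        obtain ⟨r, hr, h⟩ := smul_mem_unitBall hz
        filter_upwards [Metric.ball_mem_nhds (0 : ℂ) (show (0 : ℝ) < r by linarith)] with t ht
        have ht' := h t (by simpa using ht)
        have h1 : HasDerivAt (fun t : ℂ => t • z) z t := by
          simpa using (hasDerivAt_id t).smul_const z
        have h2 := ((hF _ ht').differentiableAt
          ((isOpen_unitBall n).mem_nhds ht')).hasFDerivAt.comp_hasDerivAt t h1
        rw [show (fun t : ℂ => F (t • z)) = F ∘ fun t : ℂ => t • z from rfl, h2.deriv]
        have h3 : ∀ L : (Fin n → ℂ) →L[ℂ] ℂ, L z = ∑ j, z j * L (Pi.single j 1) := fun L => by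
          conv_lhs => rw [pi_eq_sum_univ' z]
          simp [map_sum]
        exact h3 _
      rw [iteratedDeriv_succ', hderiv.iteratedDeriv_eq, iteratedDeriv_fun_sum fun j _ =>
        contDiffAt_const.mul (contDiffAt_slice (hF' j) hz _), map_sum]
      refine Finset.sum_congr rfl fun j _ => ?_
      rw [iteratedDeriv_const_mul _ (contDiffAt_slice (hF' j) hz _), hq' j z hz, map_mul,
        MvPolynomial.eval_X]

theorem circle_average_slice {F : (Fin n → ℂ) → ℂ} (hF : DifferentiableOn ℂ F (unitBall n))
    {z : Fin n → ℂ} (hz : z ∈ unitBall n) (d : ℕ) :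
    ∫ θ in (0 : ℝ)..2 * Real.pi, F (circleMap 0 1 θ • z) * conj (circleMap 0 1 θ) ^ d =
      2 * Real.pi / d.factorial * iteratedDeriv d (fun t : ℂ => F (t • z)) 0 := by
  obtain ⟨r, hr, h⟩ := smul_mem_unitBall hz
  have h1 := DifferentiableOn.circleIntegral_one_div_sub_center_pow_smul (c := 0) one_pos d
    ((differentiableOn_slice hF h).mono (Metric.closedBall_subset_ball hr))
  rw [circleIntegral] at h1
  have h2 : ∀ θ : ℝ, deriv (circleMap 0 1) θ •
      ((1 / (circleMap 0 1 θ - 0) ^ (d + 1)) • F (circleMap 0 1 θ • z)) =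
      Complex.I * (F (circleMap 0 1 θ • z) * conj (circleMap 0 1 θ) ^ d) := by
    intro θ
    have hne : circleMap 0 1 θ ≠ 0 := circleMap_ne_center one_ne_zero
    have hinv : conj (circleMap 0 1 θ) = (circleMap 0 1 θ)⁻¹ := by
      rw [Complex.inv_def, Complex.normSq_eq_norm_sq]
      simp
    have hpow : circleMap 0 1 θ * (1 / circleMap 0 1 θ ^ (d + 1)) = (circleMap 0 1 θ)⁻¹ ^ d := by
      rw [inv_pow, pow_succ]
      field_simp
    rw [hinv, deriv_circleMap, smul_eq_mul, smul_eq_mul, sub_zero, ← hpow]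
    ring
  simp only [h2] at h1
  rw [intervalIntegral.integral_const_mul, smul_eq_mul] at h1
  have := Complex.I_ne_zero
  refine mul_left_cancel₀ this (h1.trans ?_)
  ring

theorem eval_smul_of_isHomogeneous {q : MvPolynomial (Fin n) ℂ} {d : ℕ} (hq : q.IsHomogeneous d)
    (c : ℂ) (z : Fin n → ℂ) :
    MvPolynomial.eval (c • z) q = c ^ d * MvPolynomial.eval z q := by
  rw [MvPolynomial.eval_eq', MvPolynomial.eval_eq', Finset.mul_sum]
  refine Finset.sum_congr rfl fun m hm => ?_
  have hd : ∑ i, m i = d := by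
    rw [← hq (MvPolynomial.mem_support_iff.1 hm), Finsupp.weight_apply,
      Finsupp.sum_fintype _ _ (by simp)]
    simp
  simp only [Pi.smul_apply, smul_eq_mul, mul_pow, Finset.prod_mul_distrib,
    Finset.prod_pow_eq_pow_sum, hd]
  ring

/-- Rotations by `e^{iθ}` preserve Lebesgue measure. -/
theorem measurePreserving_circleMap_smul (θ : ℝ) :
    MeasurePreserving fun w : Fin n → ℂ => circleMap 0 1 θ • w := by
  have hn : ‖circleMap 0 1 θ‖ = 1 := by simp
  let u : Circle := ⟨circleMap 0 1 θ, by simp [Submonoid.unitSphere]⟩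
  refine volume_preserving_pi (f := fun _ : Fin n => fun x : ℂ => circleMap 0 1 θ * x) fun _ => ?_
  exact (rotation u).measurePreserving

theorem measurableEmbedding_circleMap_smul (θ : ℝ) :
    MeasurableEmbedding fun w : Fin n → ℂ => circleMap 0 1 θ • w :=
  (Homeomorph.smulOfNeZero (α := Fin n → ℂ) _
    (circleMap_ne_center one_ne_zero)).measurableEmbedding

theorem sum_norm_circleMap_smul (θ : ℝ) (w : Fin n → ℂ) :
    ∑ i, ‖(circleMap 0 1 θ • w) i‖ ^ 2 = ∑ i, ‖w i‖ ^ 2 := by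
  simp

theorem circleMap_smul_mem_unitBall_iff (θ : ℝ) (w : Fin n → ℂ) :
    circleMap 0 1 θ • w ∈ unitBall n ↔ w ∈ unitBall n := by
  show _ < (1 : ℝ) ↔ _ < (1 : ℝ)
  rw [sum_norm_circleMap_smul]

theorem preimage_circleMap_smul_unitBall (θ : ℝ) :
    (fun w : Fin n → ℂ => circleMap 0 1 θ • w) ⁻¹' unitBall n = unitBall n :=
  Set.ext fun w => circleMap_smul_mem_unitBall_iff θ w

/-- Averaging an integral over the ball along the circle action. -/
theorem two_pi_mul_setIntegral_unitBall {G : (Fin n → ℂ) → ℂ} (hc : ContinuousOn G (unitBall n))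
    (hi : IntegrableOn G (unitBall n)) :
    2 * Real.pi * ∫ z in unitBall n, G z =
      ∫ z in unitBall n, ∫ θ in (0 : ℝ)..2 * Real.pi, G (circleMap 0 1 θ • z) := by
  have hrot : ∀ (θ : ℝ) (H : (Fin n → ℂ) → ℂ),
      ∫ z in unitBall n, H (circleMap 0 1 θ • z) = ∫ z in unitBall n, H z := by
    intro θ H
    have := (measurePreserving_circleMap_smul θ).setIntegral_preimage_emb
      (measurableEmbedding_circleMap_smul θ) H (unitBall n)
    rwa [preimage_circleMap_smul_unitBall] at this
  have hrotn : ∀ θ : ℝ, ∫ z in unitBall n, ‖G (circleMap 0 1 θ • z)‖ =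
      ∫ z in unitBall n, ‖G z‖ := by
    intro θ
    have := (measurePreserving_circleMap_smul θ).setIntegral_preimage_emb
      (measurableEmbedding_circleMap_smul θ) (fun z => ‖G z‖) (unitBall n)
    rwa [preimage_circleMap_smul_unitBall] at this
  have hroti : ∀ θ : ℝ, IntegrableOn (fun z => G (circleMap 0 1 θ • z)) (unitBall n) := by
    intro θ
    have := ((measurePreserving_circleMap_smul θ).integrableOn_comp_preimage
      (measurableEmbedding_circleMap_smul θ)).2 hi
    rwa [preimage_circleMap_smul_unitBall] at this
  have hmeas : AEStronglyMeasurable (Function.uncurry fun (θ : ℝ) (z : Fin n → ℂ) =>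
      G (circleMap 0 1 θ • z))
      ((volume.restrict (Set.uIoc 0 (2 * Real.pi))).prod (volume.restrict (unitBall n))) := by
    rw [Measure.prod_restrict]
    refine ContinuousOn.aestronglyMeasurable ?_
      (measurableSet_uIoc.prod (isOpen_unitBall n).measurableSet)
    have h1 : Continuous fun p : ℝ × (Fin n → ℂ) => circleMap 0 1 p.1 • p.2 := by
      have := continuous_circleMap 0 1
      fun_prop
    exact hc.comp h1.continuousOn fun p hp => (circleMap_smul_mem_unitBall_iff _ _).2 hp.2
  have hint : Integrable (Function.uncurry fun (θ : ℝ) (z : Fin n → ℂ) =>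
      G (circleMap 0 1 θ • z))
      ((volume.restrict (Set.uIoc 0 (2 * Real.pi))).prod (volume.restrict (unitBall n))) := by
    refine (integrable_prod_iff hmeas).2 ⟨Eventually.of_forall hroti, ?_⟩
    simp only [Function.uncurry, hrotn]
    exact (intervalIntegrable_const :
      IntervalIntegrable (fun _ => ∫ z in unitBall n, ‖G z‖) volume 0 (2 * Real.pi)).def'
  rw [← intervalIntegral_integral_swap hint]
  simp only [hrot]
  simp

/-- A holomorphic function in `L²(𝔹ⁿ, μ)` orthogonal to all homogeneous polynomials vanishes:
pairing it with its own Taylor polynomial of degree `d` and averaging over the circle action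
gives a multiple of the squared norm of that polynomial. -/
theorem eq_zero_of_forall_inner_polyL2 {f : WeightedL2 n} (hf : f ∈ bergmanSpace n)
    (h : ∀ (d : ℕ) (q : MvPolynomial (Fin n) ℂ), q.IsHomogeneous d → inner ℂ (polyL2 n q) f = 0) :
    f = 0 := by
  obtain ⟨F, hF, hfF⟩ := hf
  choose q hq hq' using fun d => exists_isHomogeneous_taylor d hF
  have hzero : ∀ d, polyL2 n (q d) = 0 := by
    intro d
    set G : (Fin n → ℂ) → ℂ := fun z => F z * conj (MvPolynomial.eval z (q d)) *
      (expNegInvGlue (1 - ∑ i, ‖z i‖ ^ 2) : ℝ) with hG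
    have hμ : ∀ {H : (Fin n → ℂ) → ℂ}, ∫ z, H z ∂weightedVolume n = ∫ z in unitBall n,
        H z * (expNegInvGlue (1 - ∑ i, ‖z i‖ ^ 2) : ℝ) := by
      intro H
      rw [integral_weightedVolume]
      refine (setIntegral_eq_integral_of_forall_compl_eq_zero fun z hz => ?_).symm
      rw [expNegInvGlue_eq_zero_of_notMem hz, Complex.ofReal_zero, mul_zero]
    have hGint : IntegrableOn G (unitBall n) := by
      refine (integrable_weightedVolume_iff.1 ?_).integrableOn
      refine ((memLp_mulPoly 1 (q d) f).integrable (by norm_num)).congr ?_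
      filter_upwards [hfF] with z hz
      rw [hz, map_one, one_mul, mul_comm]
    have hGc : ContinuousOn G (unitBall n) :=
      (hF.continuousOn.mul (contDiff_conj_eval (q d)).continuous.continuousOn).mul
        (contDiff_radial (m := 0) (expNegInvGlue.contDiff (n := 0))).continuous.continuousOn
    have hG0 : ∫ z in unitBall n, G z = 0 := by
      rw [hG, ← hμ, ← h d (q d) (hq d), inner_polyL2_left]
      refine integral_congr_ae ?_
      filter_upwards [hfF] with z hz
      rw [hz]
    have hav := two_pi_mul_setIntegral_unitBall hGc hGint
    have hav' : ∀ z ∈ unitBall n, ∫ θ in (0 : ℝ)..2 * Real.pi, G (circleMap 0 1 θ • z) =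
        2 * Real.pi / d.factorial * (MvPolynomial.eval z (q d) *
          conj (MvPolynomial.eval z (q d)) * (expNegInvGlue (1 - ∑ i, ‖z i‖ ^ 2) : ℝ)) := by
      intro z hz
      have e : ∀ θ : ℝ, G (circleMap 0 1 θ • z) = (F (circleMap 0 1 θ • z) *
          conj (circleMap 0 1 θ) ^ d) * (conj (MvPolynomial.eval z (q d)) *
            (expNegInvGlue (1 - ∑ i, ‖z i‖ ^ 2) : ℝ)) := by
        intro θ
        simp only [hG]
        rw [eval_smul_of_isHomogeneous (hq d), sum_norm_circleMap_smul, map_mul, map_pow]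
        ring
      simp only [e]
      rw [intervalIntegral.integral_mul_const, circle_average_slice hF hz, hq' d z hz]
      ring
    rw [hG0, mul_zero, setIntegral_congr_fun (isOpen_unitBall n).measurableSet hav',
      integral_const_mul, ← hμ] at hav
    have hne : (2 * Real.pi / d.factorial : ℂ) ≠ 0 := by
      refine div_ne_zero (by simp [Real.pi_ne_zero]) ?_
      exact_mod_cast d.factorial_ne_zero
    have h0 := (mul_eq_zero.1 hav.symm).resolve_left hne
    rw [← inner_self_eq_zero (𝕜 := ℂ), inner_polyL2_left, ← h0]
    refine integral_congr_ae ?_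
    filter_upwards [coeFn_polyL2 (q d)] with z hz
    rw [hz]
  have hae : ∀ d, ∀ᵐ z ∂weightedVolume n, MvPolynomial.eval z (q d) = 0 := by
    intro d
    have h1 := coeFn_polyL2 (q d)
    rw [hzero d] at h1
    filter_upwards [h1, Lp.coeFn_zero ℂ 2 (weightedVolume n)] with z h2 h3
    rw [← h2, h3]
    rfl
  refine Lp.ext ?_
  filter_upwards [hfF, ae_all_iff.2 hae, ae_mem_unitBall, Lp.coeFn_zero ℂ 2 (weightedVolume n)]
    with z h1 h2 hz h3
  rw [h1, h3]
  obtain ⟨r, hr, hrz⟩ := smul_mem_unitBall hz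
  have hs := Complex.hasSum_taylorSeries_on_ball (differentiableOn_slice hF hrz)
    (show (1 : ℂ) ∈ Metric.ball 0 r by simpa using hr)
  simp only [hq' _ z hz, h2, smul_zero, one_smul] at hs
  exact hs.unique hasSum_zero

end

/-! ### The projection and its derivatives -/

section

variable {n : ℕ}

theorem polyL2_mem_bergmanSpace (q : MvPolynomial (Fin n) ℂ) : polyL2 n q ∈ bergmanSpace n :=
  ⟨fun z => MvPolynomial.eval z q,
    (AnalyticOnNhd.eval_mvPolynomial q).differentiableOn.mono (Set.subset_univ _), coeFn_polyL2 q⟩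

theorem summable_homogeneousPart (f : WeightedL2 n) : Summable fun d => homogeneousPart d f := by
  refine ((orthogonalFamily_homogeneousSpace n).summable_iff_norm_sq_summable
    fun d => ⟨homogeneousPart d f, homogeneousPart_mem d f⟩).2 ?_
  exact summable_of_sum_range_le (fun _ => by positivity) fun N =>
    sum_norm_homogeneousPart_sq_le f (Finset.range N)

theorem inner_polyL2_homogeneousPart {q : MvPolynomial (Fin n) ℂ} {d : ℕ} (hq : q.IsHomogeneous d)
    (f : WeightedL2 n) : inner ℂ (polyL2 n q) (homogeneousPart d f) = inner ℂ (polyL2 n q) f := by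
  rw [homogeneousPart, ← Submodule.inner_starProjection_left_eq_right,
    Submodule.starProjection_eq_self_iff.2 (show polyL2 n q ∈ homogeneousSpace n d from
      Submodule.mem_map_of_mem hq)]

/-- The weighted Bergman projection of `f` is the sum of the homogeneous components of `f`. -/
theorem hasSum_homogeneousPart (f : WeightedL2 n) :
    HasSum (fun d => homogeneousPart d f) (bergmanProjection n f) := by
  set s := ∑' d, homogeneousPart d f with hs
  have hsum : HasSum (fun d => homogeneousPart d f) s := (summable_homogeneousPart f).hasSum
  have hmem : ∀ d, homogeneousPart d f ∈ bergmanSpace n := fun d => by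
    obtain ⟨q, -, hq⟩ := exists_polyL2_eq_homogeneousPart d f
    rw [← hq]
    exact polyL2_mem_bergmanSpace q
  have hsB : s ∈ bergmanSpace n :=
    (isClosed_bergmanSpace n).mem_of_tendsto hsum
      (Eventually.of_forall fun t => (bergmanSpace n).sum_mem fun d _ => hmem d)
  have horth : ∀ (d : ℕ) (q : MvPolynomial (Fin n) ℂ), q.IsHomogeneous d →
      inner ℂ (polyL2 n q) (f - s) = 0 := by
    intro d q hq
    have h1 : HasSum (fun e => inner ℂ (polyL2 n q) (homogeneousPart e f))
        (inner ℂ (polyL2 n q) s) := hsum.mapL (innerSL ℂ (polyL2 n q))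
    have h2 : HasSum (fun e => inner ℂ (polyL2 n q) (homogeneousPart e f))
        (inner ℂ (polyL2 n q) (homogeneousPart d f)) := by
      refine hasSum_single d fun e he => ?_
      obtain ⟨r, hr, hre⟩ := exists_polyL2_eq_homogeneousPart e f
      rw [← hre]
      exact inner_polyL2_of_isHomogeneous hr hq he
    rw [inner_sub_right, h1.unique h2, inner_polyL2_homogeneousPart hq, sub_self]
  have h0 : bergmanProjection n (f - s) = 0 := by
    refine eq_zero_of_forall_inner_polyL2 (Submodule.starProjection_apply_mem _ _) fun d q hq => ?_
    rw [bergmanProjection, ← Submodule.inner_starProjection_left_eq_right,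
      Submodule.starProjection_eq_self_iff.2 (polyL2_mem_bergmanSpace q), horth d q hq]
  rw [map_sub, sub_eq_zero] at h0
  rw [h0, bergmanProjection, Submodule.starProjection_eq_self_iff.2 hsB]
  exact hsum

theorem isWeakDeriv_bergmanProjection_of_ne_zero {β γ : Fin n → ℕ} (hβ : β ≠ 0)
    (f : WeightedL2 n) : IsWeakDeriv β γ (bergmanProjection n f) 0 := by
  obtain ⟨β, j, rfl⟩ := exists_eq_add_single hβ
  choose q _ hq using fun d => exists_polyL2_eq_homogeneousPart d f
  have h : IsWeakDeriv (Pi.single j 1) 0 (bergmanProjection n f) 0 := by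
    refine IsWeakDeriv.of_tendsto (v := fun _ => 0) (fun N => ?_)
      (hasSum_homogeneousPart f).tendsto_sum_nat tendsto_const_nhds
    rw [← Finset.sum_congr rfl fun d _ => hq d, ← map_sum]
    exact isWeakDeriv_polyL2_dzbar _ j
  exact (isWeakDeriv_add_single_left_iff h).2 (isWeakDeriv_zero_zero β γ)

/-- The holomorphic derivatives of the projection are obtained termwise from the homogeneous
components. The growth of `∂^γ` on polynomials of degree `d` is compensated by the decay of the
components of `f`. -/
theorem exists_weakDeriv_bergmanProjection (hn : 1 ≤ n) {k : ℕ} (γ : Fin n → ℕ)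
    (hγ : ∑ i, γ i ≤ k) : ∃ C : ℝ, 0 ≤ C ∧ ∀ f : WeightedL2 n, MemSobolev k f →
      ∃ g, IsWeakDeriv 0 γ (bergmanProjection n f) g ∧ ‖g‖ ^ 2 ≤ C * sobolevNorm k f ^ 2 := by
  obtain ⟨A, hA, D, hD, hD'⟩ := exists_polynomial_deriv hn γ
  obtain ⟨B, hB, hB'⟩ := exists_sum_homogeneousPart_le k (MvPolynomial.isHomogeneous_one (Fin n) ℂ)
    (MvPolynomial.isHomogeneous_one (Fin n) ℂ)
  refine ⟨A * B, mul_nonneg hA hB, fun f hf => ?_⟩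
  set m := ∑ i, γ i with hm
  choose q hq hqf using fun d => exists_polyL2_eq_homogeneousPart d f
  set v : ℕ → WeightedL2 n := fun e => polyL2 n (D (q (m + e))) with hv
  have hvmem : ∀ e, v e ∈ homogeneousSpace n e := fun e => by
    have h1 := (hD' _ _ (hq (m + e))).1
    rw [Nat.add_sub_cancel_left] at h1
    exact Submodule.mem_map_of_mem h1
  have hvbound : ∀ e, ‖v e‖ ^ 2 ≤
      A * ((1 + (m + e : ℕ) : ℝ) ^ (2 * k) * ‖homogeneousPart (m + e) f‖ ^ 2) := fun e => by
    refine (hD' _ _ (hq (m + e))).2.2.trans ?_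
    rw [hqf, mul_assoc]
    refine mul_le_mul_of_nonneg_left (mul_le_mul_of_nonneg_right
      (pow_le_pow_right₀ ?_ (by omega)) (by positivity)) hA
    have : (0 : ℝ) ≤ (m + e : ℕ) := Nat.cast_nonneg _
    linarith
  have hsumle : ∀ N, ∑ e ∈ Finset.range N, ‖v e‖ ^ 2 ≤ A * B * sobolevNorm k f ^ 2 := fun N => by
    refine (Finset.sum_le_sum fun e _ => hvbound e).trans ?_
    rw [← Finset.mul_sum, mul_assoc]
    refine mul_le_mul_of_nonneg_left ?_ hA
    refine le_trans ?_ (hB' f hf (m + N))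
    rw [Finset.sum_range_add]
    simp only [mulPoly_one_one]
    exact le_add_of_nonneg_left (Finset.sum_nonneg fun _ _ => by positivity)
  have hvsum : Summable v :=
    ((orthogonalFamily_homogeneousSpace n).summable_iff_norm_sq_summable
      fun e => ⟨v e, hvmem e⟩).2 (summable_of_sum_range_le (fun _ => by positivity) hsumle)
  have htend := hvsum.hasSum.tendsto_sum_nat
  refine ⟨∑' e, v e, ?_, ?_⟩
  · refine IsWeakDeriv.of_tendsto (fun N => ?_)
      ((tendsto_add_atTop_iff_nat m).2 (hasSum_homogeneousPart f).tendsto_sum_nat) htend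
    rw [← Finset.sum_congr rfl fun d _ => hqf d, ← map_sum, hv]
    simp only
    rw [← map_sum]
    have h1 : ∑ e ∈ Finset.range N, D (q (m + e)) = D (∑ d ∈ Finset.range (N + m), q d) := by
      rw [add_comm N m, Finset.sum_range_add, map_add, map_sum, map_sum,
        Finset.sum_eq_zero fun d hd => (hD' _ _ (hq d)).2.1 (Finset.mem_range.1 hd), zero_add]
    rw [h1]
    exact hD _
  · refine le_of_tendsto (htend.norm.pow 2) (Eventually.of_forall fun N => ?_)
    rw [show ‖∑ e ∈ Finset.range N, v e‖ ^ 2 = ∑ e ∈ Finset.range N, ‖v e‖ ^ 2 from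
      (orthogonalFamily_homogeneousSpace n).norm_sum (fun e => ⟨v e, hvmem e⟩) _]
    exact hsumle N

end

end WeightedBergman

end

theorem theorem2 (n : ℕ) (hn : 1 ≤ n) (k : ℕ) :
    ∃ C : ℝ, ∀ f : WeightedBergman.WeightedL2 n, WeightedBergman.MemSobolev k f →
      WeightedBergman.MemSobolev k (WeightedBergman.bergmanProjection n f) ∧
        WeightedBergman.sobolevNorm k (WeightedBergman.bergmanProjection n f) ≤
          C * WeightedBergman.sobolevNorm k f := by
  open WeightedBergman in
  have key : ∀ p : (Fin n → ℕ) × (Fin n → ℕ), ∃ C : ℝ, 0 ≤ C ∧ (p ∈ multiIndices n k →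
      ∀ f : WeightedL2 n, MemSobolev k f → ∃ g, IsWeakDeriv p.1 p.2 (bergmanProjection n f) g ∧
        ‖g‖ ^ 2 ≤ C * sobolevNorm k f ^ 2) := by
    rintro ⟨β, γ⟩
    by_cases hp : (β, γ) ∈ multiIndices n k
    · by_cases hβ : β = 0
      · subst hβ
        obtain ⟨C, hC, h⟩ := exists_weakDeriv_bergmanProjection hn γ
          (by simpa using mem_multiIndices.1 hp)
        exact ⟨C, hC, fun _ => h⟩
      · exact ⟨0, le_rfl, fun _ f _ =>
          ⟨0, isWeakDeriv_bergmanProjection_of_ne_zero hβ f, by simp⟩⟩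
    · exact ⟨0, le_rfl, fun h => absurd h hp⟩
  open WeightedBergman in
  choose C hC hCg using key
  refine ⟨√(∑ p ∈ WeightedBergman.multiIndices n k, C p), fun f hf => ⟨fun p hp => ?_, ?_⟩⟩
  · obtain ⟨g, hg, -⟩ := hCg p hp f hf
    exact ⟨g, hg⟩
  · refine le_of_sq_le_sq ?_ (mul_nonneg (Real.sqrt_nonneg _)
      (WeightedBergman.sobolevNorm_nonneg k f))
    rw [mul_pow, Real.sq_sqrt (Finset.sum_nonneg fun p _ => hC p),
      WeightedBergman.sobolevNorm_sq, Finset.sum_mul]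
    refine Finset.sum_le_sum fun p hp => ?_
    obtain ⟨g, hg, hgn⟩ := hCg p hp f hf
    rw [WeightedBergman.weakDeriv_eq hg]
    exact hgn
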